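/- \textbf{Setting.} Let $N\ge 1$, $n,m_1,\dots,m_N$ be natural numbers. Consider the switched linear system $$\dot x(t)=A_{\sigma(t)}x(t)+B_{\sigma(t)}u_{\sigma(t)}(t),\qquad A_i\in\mathbb R^{n\times n},\ B_i\in\mathbb R^{n\times m_i}\ (i=1,\dots,N),$$ with a piecewise constant switching signal $\sigma$ with values in $\{1,\dots,N\}$, having finitely many switches on bounded intervals, and piecewise continuous inputs $u_i$ with values in $\mathbb R^{m_i}$, both free to choose. The system is \emph{controllable} if for every $x_0\in\mathbb R^n$ there are a finite time $t_f>0$, a switching signal on $[0,t_f)$ and an input such that $x(0)=x_0$ and $x(t_f)=0$. Let now the $A_i$ and $B_i$ be \emph{structured matrices}: each entry is either fixed to be zero, or a free parameter (a ``nonzero entry'') that can take any real value (including zero) independently of all the others. A \emph{realization} is obtained by assigning real values to the free parameters. The generic rank ${\rm grank}\,M$ of a structured matrix $M$ is the maximum rank of its realizations. The system is \emph{structurally controllable} if it has a controllable realization. The \emph{colored union graph} ${\cal G}_c$ is the directed multigraph with state vertices $X=\{x_1,\dots,x_n\}$ and input vertices $u^i_k$ ($1\le i\le N$, $1\le k\le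 m_i$), with an edge of color $i$ from $x_k$ to $x_j$ for each nonzero entry $(j,k)$ of $A_i$, and an edge of color $i$ from $u^i_k$ to $x_j$ for each nonzero entry $(j,k)$ of $B_i$. A state vertex is \emph{input-reachable} if ${\cal G}_c$ contains a path to it from some input vertex. A set of edges is \emph{S-disjoint} if their heads are pairwise distinct and any two of them with the same tail have different colors. A cycle is a closed walk of positive length in which only the initial vertex is repeated, once, at the end; cycles are counted up to the choice of the initial vertex. A \emph{generalized stem} is a subgraph of ${\cal G}_c$ that has exactly one input vertex and no cycle, in which every state vertex has exactly one ingoing edge, and whose edges are S-disjoint. A \emph{generalized bud} is a subgraph of ${\cal G}_c$ that has no input vertex and exactly one cycle, all of whose vertices are input-reachable in ${\cal G}_c$, in which every vertex has exactly one ingoing edge, and whose edges are S-disjoint. \textbf{Theorem.} The following conditions are equivalent: \begin{itemize} \item[(a)] every state vertex $x_j\in X$ is input-reachable in ${\cal G}_c$, and ${\rm grank}[A_1,\dots,A_N,B_1,\dots,B_N]=n$; \item[(b)] ${\cal G}_c$ contains a collection of pairwise vertex-disjoint generalized stems and generalized buds that cover $X$ (a generalized cactus configuration covering $X$); \item[(c)]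 the system is structurally controllable. \end{itemize} -/

import Mathlib

open Set Filter Topology

/-! ### Switched linear systems and controllability -/

/-- A (numerical) switched linear system `(A_i, B_i)`, `i = 1, …, N`, with state space `ℝⁿ`; the
`i`-th subsystem has `m i` inputs. -/
structure SwitchedSystem (n N : ℕ) (m : Fin N → ℕ) where
  A : Fin N → Matrix (Fin n) (Fin n) ℝ
  B : ∀ i : Fin N, Matrix (Fin n) (Fin (m i)) ℝ

/-- `σ` is a switching signal on `[0, tf)`: it is piecewise constant (and right-continuous), with
finitely many switching times, i.e. it is constant on every subinterval `[s, t]` such that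
`(s, t]` contains no switching time. -/
def IsSwitchingSignal {N : ℕ} (tf : ℝ) (σ : ℝ → Fin N) : Prop :=
  ∃ S : Finset ℝ, ∀ s t : ℝ, 0 ≤ s → s ≤ t → t < tf → (∀ r ∈ S, r ∉ Ioc s t) → σ s = σ t

/-- `f` is piecewise continuous on `[0, tf]`: it is continuous except at finitely many points, and
it has finite one-sided limits everywhere. -/
def IsPiecewiseContinuous {k : ℕ} (tf : ℝ) (f : ℝ → Fin k → ℝ) : Prop :=
  (∃ S : Finset ℝ, ∀ t ∈ Ioo 0 tf, t ∉ S → ContinuousAt f t) ∧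
  (∀ t ∈ Ico 0 tf, ∃ l, Tendsto f (𝓝[>] t) (𝓝 l)) ∧
  (∀ t ∈ Ioc 0 tf, ∃ l, Tendsto f (𝓝[<] t) (𝓝 l))

namespace SwitchedSystem

variable {n N : ℕ} {m : Fin N → ℕ}

/-- `x` is a solution on `[0, tf]` of `ẋ(t) = A_{σ(t)} x(t) + B_{σ(t)} u_{σ(t)}(t)`: it is
continuous and satisfies the equation except at finitely many times. -/
def IsTrajectory (sys : SwitchedSystem n N m) (tf : ℝ) (σ : ℝ → Fin N)
    (u : ∀ i : Fin N, ℝ → Fin (m i) → ℝ) (x : ℝ → Fin n → ℝ) : Prop :=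
  ContinuousOn x (Icc 0 tf) ∧
  ∃ S : Finset ℝ, ∀ t ∈ Ioo 0 tf, t ∉ S →
    HasDerivAt x ((sys.A (σ t)).mulVec (x t) + (sys.B (σ t)).mulVec (u (σ t) t)) t

/-- The state `x₀` is controllable: it can be steered to the origin in finite time by some
switching signal and some piecewise continuous input. -/
def IsControllableState (sys : SwitchedSystem n N m) (x₀ : Fin n → ℝ) : Prop :=
  ∃ tf : ℝ, 0 < tf ∧ ∃ σ : ℝ → Fin N, IsSwitchingSignal tf σ ∧
    ∃ u : ∀ i : Fin N, ℝ → Fin (m i) → ℝ, (∀ i, IsPiecewiseContinuous tf (u i)) ∧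
      ∃ x : ℝ → Fin n → ℝ, sys.IsTrajectory tf σ u x ∧ x 0 = x₀ ∧ x tf = 0

/-- The system is controllable: its controllable set is the whole of `ℝⁿ`. -/
def IsControllable (sys : SwitchedSystem n N m) : Prop :=
  {x₀ : Fin n → ℝ | sys.IsControllableState x₀} = univ

end SwitchedSystem

/-! ### Structured matrices and structured systems -/

/-- A structured matrix is given by its zero-nonzero pattern: `P i j` says that the entry `(i, j)`
is a free parameter (a "nonzero entry"); the other entries are fixed to be zero. -/
abbrev StructuredMatrix (ι κ : Type*) := ι → κ → Prop

namespace StructuredMatrix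

variable {ι κ : Type*}

/-- `M` arises by giving real values (possibly zero) to the free entries. -/
def IsRealization (P : StructuredMatrix ι κ) (M : Matrix ι κ ℝ) : Prop :=
  ∀ i j, ¬ P i j → M i j = 0

/-- The generic rank: the maximal rank of a realization. -/
noncomputable def grank [Fintype κ] (P : StructuredMatrix ι κ) : ℕ :=
  sSup {r : ℕ | ∃ M : Matrix ι κ ℝ, P.IsRealization M ∧ M.rank = r}

/-- The supremum that defines the generic rank is a maximum. -/
theorem isGreatest_grank [Fintype κ] (P : StructuredMatrix ι κ) :
    IsGreatest {r : ℕ | ∃ M : Matrix ι κ ℝ, P.IsRealization M ∧ M.rank = r} P.grank := by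
  have hb : BddAbove {r : ℕ | ∃ M : Matrix ι κ ℝ, P.IsRealization M ∧ M.rank = r} := by
    refine ⟨Fintype.card κ, ?_⟩
    rintro r ⟨M, -, rfl⟩
    exact M.rank_le_card_width
  exact ⟨Nat.sSup_mem ⟨_, 0, fun _ _ _ => rfl, rfl⟩ hb, fun r hr => le_csSup hb hr⟩

end StructuredMatrix

/-- A structured switched system: the patterns of the matrices `A_i` and `B_i`. -/
structure StructuredSystem (n N : ℕ) (m : Fin N → ℕ) where
  A : Fin N → StructuredMatrix (Fin n) (Fin n)
  B : ∀ i : Fin N, StructuredMatrix (Fin n) (Fin (m i))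

namespace StructuredSystem

variable {n N : ℕ} {m : Fin N → ℕ}

/-- A numerical system is a realization if all its matrices are realizations of the patterns. -/
def IsRealization (P : StructuredSystem n N m) (sys : SwitchedSystem n N m) : Prop :=
  ∀ i, (P.A i).IsRealization (sys.A i) ∧ (P.B i).IsRealization (sys.B i)

/-- Structural controllability: some realization is controllable. -/
def IsStructurallyControllable (P : StructuredSystem n N m) : Prop :=
  ∃ sys : SwitchedSystem n N m, P.IsRealization sys ∧ sys.IsControllable

/-- The structured matrix `[A_1, …, A_N, B_1, …, B_N]`. Its columns are indexed by the pairs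
`(i, k)` (`k`-th column of `A_i`, resp. of `B_i`). -/
def concat (P : StructuredSystem n N m) :
    StructuredMatrix (Fin n) ((Fin N × Fin n) ⊕ (Σ i : Fin N, Fin (m i))) :=
  fun j c => Sum.elim (fun p => P.A p.1 j p.2) (fun q => P.B q.1 j q.2) c

end StructuredSystem

/-! ### Colored digraphs -/

/-- Vertices of the colored union graph: state vertices `x_1, …, x_n`, and one input vertex
`u^i_k` for every `i` and every `k = 1, …, m_i`. -/
inductive Vertex (n N : ℕ) (m : Fin N → ℕ) where
  | state (j : Fin n) : Vertex n N m
  | input (i : Fin N) (k : Fin (m i)) : Vertex n N m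

/-- A colored edge from `tail` to `head`. Edges with the same ends and different colors differ. -/
@[ext] structure ColoredEdge (n N : ℕ) (m : Fin N → ℕ) where
  tail : Vertex n N m
  color : Fin N
  head : Vertex n N m

section Walks

variable {n N : ℕ} {m : Fin N → ℕ}

/-- `es` is (the list of edges of) a walk from `v` to `w` with edges in `E`. -/
def IsWalk (E : Set (ColoredEdge n N m)) :
    Vertex n N m → List (ColoredEdge n N m) → Vertex n N m → Prop
  | v, [], w => v = w
  | v, e :: es, w => e ∈ E ∧ e.tail = v ∧ IsWalk E e.head es w

/-- A path: a walk without repeated vertices. -/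
def IsPath (E : Set (ColoredEdge n N m)) (v : Vertex n N m) (es : List (ColoredEdge n N m))
    (w : Vertex n N m) : Prop :=
  IsWalk E v es w ∧ (v :: es.map ColoredEdge.head).Nodup

/-- `C` is the edge set of a cycle of the edge set `E`: a nonempty closed walk in which only the
initial vertex is repeated, once, at the end. A cycle is identified with its set of edges, so
that the choice of the initial vertex does not matter. -/
def IsCycle (E C : Set (ColoredEdge n N m)) : Prop :=
  ∃ (v : Vertex n N m) (es : List (ColoredEdge n N m)), es ≠ [] ∧ IsWalk E v es v ∧
    (es.map ColoredEdge.head).Nodup ∧ C = {e | e ∈ es}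

/-- The edges in `E` are S-disjoint: their heads are distinct, and edges with the same tail have
different colors. -/
def SDisjoint (E : Set (ColoredEdge n N m)) : Prop :=
  ∀ e ∈ E, ∀ f ∈ E, e ≠ f → e.head ≠ f.head ∧ (e.tail = f.tail → e.color ≠ f.color)

end Walks

namespace StructuredSystem

variable {n N : ℕ} {m : Fin N → ℕ}

/-- The edges of the colored union graph: an edge `x_k → x_j` of color `i` for every nonzero entry
`(j, k)` of `A_i`, and an edge `u^i_k → x_j` of color `i` for every nonzero entry `(j, k)` of
`B_i`. -/
def edges (P : StructuredSystem n N m) : Set (ColoredEdge n N m) :=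
  {e | (∃ (i : Fin N) (j k : Fin n), P.A i j k ∧ e = ⟨.state k, i, .state j⟩) ∨
    (∃ (i : Fin N) (j : Fin n) (k : Fin (m i)), P.B i j k ∧ e = ⟨.input i k, i, .state j⟩)}

/-- The state vertex `x_j` is input-reachable: in the colored union graph there is a path from some
input vertex to it. -/
def InputReachable (P : StructuredSystem n N m) (j : Fin n) : Prop :=
  ∃ (i : Fin N) (k : Fin (m i)) (es : List (ColoredEdge n N m)),
    IsPath P.edges (.input i k) es (.state j)

/-- A subgraph of the colored union graph (whose vertex set is all of `Vertex n N m`). -/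
structure Subgraph (P : StructuredSystem n N m) where
  verts : Set (Vertex n N m)
  edges : Set (ColoredEdge n N m)
  edges_subset : edges ⊆ P.edges
  tail_mem : ∀ e ∈ edges, e.tail ∈ verts
  head_mem : ∀ e ∈ edges, e.head ∈ verts

variable {P : StructuredSystem n N m}

/-- Generalized stem. -/
structure Subgraph.IsGeneralizedStem (G : P.Subgraph) : Prop where
  unique_input : ∃! v : Vertex n N m, v ∈ G.verts ∧ ∃ i k, v = .input i k
  no_cycle : ∀ C, ¬ IsCycle G.edges C
  unique_ingoing : ∀ j : Fin n, .state j ∈ G.verts → ∃! e, e ∈ G.edges ∧ e.head = .state j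
  sdisjoint : SDisjoint G.edges

/-- Generalized bud. -/
structure Subgraph.IsGeneralizedBud (G : P.Subgraph) : Prop where
  no_input : ∀ i k, .input i k ∉ G.verts
  unique_cycle : ∃! C, IsCycle G.edges C
  input_reachable : ∀ j : Fin n, .state j ∈ G.verts → P.InputReachable j
  unique_ingoing : ∀ j : Fin n, .state j ∈ G.verts → ∃! e, e ∈ G.edges ∧ e.head = .state j
  sdisjoint : SDisjoint G.edges

/-- The set `Xs` of states is covered by a generalized cactus configuration, i.e. by a collection
`𝒞` of pairwise vertex-disjoint generalized stems and generalized buds. -/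
def IsCoveredByGeneralizedCactus (P : StructuredSystem n N m) (Xs : Set (Fin n)) : Prop :=
  ∃ 𝒞 : Set P.Subgraph, (∀ G ∈ 𝒞, G.IsGeneralizedStem ∨ G.IsGeneralizedBud) ∧
    (∀ G ∈ 𝒞, ∀ H ∈ 𝒞, G ≠ H → Disjoint G.verts H.verts) ∧
    ∀ j ∈ Xs, ∃ G ∈ 𝒞, .state j ∈ G.verts

end StructuredSystem

/-! ### Selecting a nonzero minor -/

section Minors

/-! The combinatorial equivalence rests on matchings. By determinant expansion, full generic rank
means that the rows of `[A_1, …, B_N]` can be matched to distinct nonzero columns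
(`grank_eq_iff_exists_matching`). A matching selects one edge into each state, with distinct pairs
(tail, color): a functional graph with S-disjoint edges. A component containing an input is a
generalized stem; any other has exactly one cycle and, by reachability, is a generalized bud.
Conversely, the ingoing edges of a cactus configuration form a matching, and a state of a stem is
reachable because tracing edges backwards cannot cycle.

For (a) → (c), make the free entries independent variables, and let a polynomial row `q` annihilate
all vectors `A_{i₁} ⋯ A_{iᵣ} b_u`; then so does every `q A_i`. Reachability prevents the degree in
each single variable from growing under `q ↦ q A_i` (`degreeOf_rowStep_le`), while the lowest total
degree grows by one. Hence `q A_{i₁} ⋯ A_{iᵣ} = 0` for all words of some length `r`. Since `[A | B]`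
has trivial left kernel, the vanishing passes down to `r = 0`, so `q = 0`. Thus some maximal minor
of the word vectors is a nonzero polynomial, and at a real point where it does not vanish the word
vectors span.

Spanning gives controllability (`isControllable_of_invariant`) by maximality of dimension: among
subspaces of controllable states, those of largest dimension are permuted by pulling back along
flows, and their intersection is invariant and contains all input images.

For (c) → (a), a row annihilating every `A_i` and `B_i` is a conserved functional, and the
unreachable states form an autonomous subsystem, which by a Grönwall estimate cannot reach zero in
finite time. -/

theorem exists_det_ne_zero_of_span_eq_top {K ι κ : Type*} [Field K] [Fintype ι] [DecidableEq ι]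
    (v : κ → ι → K) (hv : Submodule.span K (range v) = ⊤) :
    ∃ g : ι → κ, (Matrix.of fun i l => v (g l) i).det ≠ 0 := by
  obtain ⟨κ', a, -, hsp, hli⟩ := exists_linearIndependent' K v
  have b : Module.Basis κ' K (ι → K) := Module.Basis.mk hli (by rw [hsp, hv])
  let e : ι ≃ κ' := (Pi.basisFun K ι).indexEquiv b
  refine ⟨fun l => a (e l), ?_⟩
  have h : LinearIndependent K (Matrix.of fun i l => v (a (e l)) i).col :=
    hli.comp e e.injective
  rw [Matrix.linearIndependent_cols_iff_isUnit, Matrix.isUnit_iff_isUnit_det] at h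
  exact h.ne_zero

theorem exists_annihilator_of_ne_top {K ι : Type*} [Field K] [Fintype ι] [DecidableEq ι]
    (W : Submodule K (ι → K)) (hW : W ≠ ⊤) :
    ∃ q : ι → K, q ≠ 0 ∧ ∀ x ∈ W, ∑ j, q j * x j = 0 := by
  obtain ⟨f, hf, hle⟩ := Submodule.exists_le_ker_of_lt_top W (lt_top_iff_ne_top.2 hW)
  have key : ∀ x, ∑ j, f (Pi.single j 1) * x j = f x := by
    intro x
    conv_rhs => rw [pi_eq_sum_univ' x, map_sum]
    refine Finset.sum_congr rfl fun j _ => ?_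
    rw [map_smul, smul_eq_mul, mul_comm]
  refine ⟨fun j => f (Pi.single j 1), fun h0 => hf ?_, fun x hx => ?_⟩
  · ext x
    simpa using congrFun h0 x
  · rw [key]
    exact hle hx

/-- A family of vectors over a domain with trivial annihilator has a nonzero maximal minor. -/
theorem exists_det_ne_zero_of_annihilator {R ι κ : Type*} [CommRing R] [IsDomain R] [Fintype ι]
    [DecidableEq ι] (v : κ → ι → R)
    (hv : ∀ q : ι → R, (∀ c, ∑ j, q j * v c j = 0) → q = 0) :
    ∃ g : ι → κ, (Matrix.of fun i l => v (g l) i).det ≠ 0 := by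
  let K := FractionRing R
  let φ := algebraMap R K
  have hφ : Function.Injective φ := IsFractionRing.injective R K
  have hspan : Submodule.span K (range fun c j => φ (v c j)) = ⊤ := by
    by_contra hne
    obtain ⟨q, hq0, hq⟩ := exists_annihilator_of_ne_top _ hne
    -- Clearing denominators turns an annihilator over the fraction field into one over `R`.
    obtain ⟨b, hb⟩ := IsLocalization.exist_integer_multiples_of_finite (nonZeroDivisors R) q
    choose p hp using hb
    have hp' : ∀ j, φ (p j) = φ b * q j := fun j => by
      rw [hp j, Algebra.smul_def]
    have hp0 : p = 0 := by
      refine hv p fun c => hφ ?_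
      have := hq _ (Submodule.subset_span ⟨c, rfl⟩)
      rw [map_sum, map_zero]
      simp only [map_mul, hp', mul_assoc]
      rw [← Finset.mul_sum, this, mul_zero]
    refine hq0 (funext fun j => ?_)
    have h := hp' j
    rw [hp0, Pi.zero_apply, map_zero] at h
    refine (mul_eq_zero.1 h.symm).resolve_left fun h0 => ?_
    exact nonZeroDivisors.coe_ne_zero b (hφ (h0.trans (map_zero φ).symm))
  obtain ⟨g, hg⟩ := exists_det_ne_zero_of_span_eq_top _ hspan
  refine ⟨g, fun h0 => hg ?_⟩
  have := RingHom.map_det φ (Matrix.of fun i l => v (g l) i)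
  rw [h0, map_zero] at this
  exact this.symm

end Minors

/-! ### The vectors reached along words -/

section Words

variable {ι κ υ S : Type*} [Fintype ι] [CommRing S]

/-- The vector `A_{i₁} ⋯ A_{iᵣ} b_u`, for the word `i₁ ⋯ iᵣ` and the column `b_u` of the input
part of `M = [A | B]`. -/
def wordVec (M : Matrix ι ((κ × ι) ⊕ υ) S) (u : υ) : List κ → ι → S
  | [] => fun j => M j (.inr u)
  | i :: w => fun j => ∑ k, M j (.inl (i, k)) * wordVec M u w k

/-- The row vector `q A_i`. -/
def rowStep (M : Matrix ι ((κ × ι) ⊕ υ) S) (q : ι → S) (i : κ) : ι → S :=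
  fun k => ∑ l, q l * M l (.inl (i, k))

theorem wordVec_map {T : Type*} [CommRing T] (φ : S →+* T) (M : Matrix ι ((κ × ι) ⊕ υ) S)
    (u : υ) (w : List κ) (j : ι) : wordVec (M.map φ) u w j = φ (wordVec M u w j) := by
  induction w generalizing j with
  | nil => rfl
  | cons i w ih => simp [wordVec, ih]

theorem sum_rowStep_mul_wordVec (M : Matrix ι ((κ × ι) ⊕ υ) S) (q : ι → S) (i : κ) (u : υ)
    (w : List κ) :
    ∑ k, rowStep M q i k * wordVec M u w k = ∑ j, q j * wordVec M u (i :: w) j := by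
  simp only [rowStep, wordVec, Finset.sum_mul, Finset.mul_sum]
  rw [Finset.sum_comm]
  simp only [mul_assoc]

end Words

/-! ### The generic realization -/

section Generic

open MvPolynomial

variable {ι κ υ : Type*}

open Classical in
/-- The generic realization of a pattern: the free entries are independent variables. -/
noncomputable def genericMatrix {γ : Type*} (P : StructuredMatrix ι γ) :
    Matrix ι γ (MvPolynomial (ι × γ) ℝ) :=
  fun j c => if P j c then X (j, c) else 0

theorem genericMatrix_eval {γ : Type*} (P : StructuredMatrix ι γ) {M : Matrix ι γ ℝ}
    (hM : P.IsRealization M) :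
    (genericMatrix P).map (eval fun e => M e.1 e.2) = M := by
  ext j c
  by_cases h : P j c
  · simp [genericMatrix, h]
  · simp [genericMatrix, h, hM j c h]

theorem isRealization_eval_genericMatrix {γ : Type*} (P : StructuredMatrix ι γ)
    (x : ι × γ → ℝ) : P.IsRealization ((genericMatrix P).map (eval x)) := by
  intro j c h
  simp [genericMatrix, h]

theorem degreeOf_genericMatrix_of_ne {γ : Type*} (P : StructuredMatrix ι γ) {j l : ι} {c d : γ}
    (h : (j, c) ≠ (l, d)) : degreeOf (j, c) (genericMatrix P l d) = 0 := by
  unfold genericMatrix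
  split_ifs
  · exact degreeOf_X_of_ne h
  · exact degreeOf_zero _

/-- The state `j` is reached by some word from some input. -/
inductive PatternReachable (P : StructuredMatrix ι ((κ × ι) ⊕ υ)) : ι → Prop
  | input {j u} (h : P j (.inr u)) : PatternReachable P j
  | step {j i k} (hk : PatternReachable P k) (h : P j (.inl (i, k))) : PatternReachable P j

variable [Fintype ι] {P : StructuredMatrix ι ((κ × ι) ⊕ υ)}

/-- Setting every variable to `1` makes all entries nonnegative, so the contribution of a path to
`k` cannot cancel. -/
theorem PatternReachable.exists_wordVec_ne_zero {k : ι} (hk : PatternReachable P k) :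
    ∃ u w, wordVec (genericMatrix P) u w k ≠ 0 := by
  let φ : MvPolynomial (ι × ((κ × ι) ⊕ υ)) ℝ →+* ℝ := eval fun _ => 1
  have hnn : ∀ j c, 0 ≤ φ (genericMatrix P j c) := by
    intro j c
    by_cases h : P j c <;> simp [φ, genericMatrix, h]
  have hone : ∀ {j c}, P j c → φ (genericMatrix P j c) = 1 := by
    intro j c h
    simp [φ, genericMatrix, h]
  have hpos : ∀ u w j, 0 ≤ φ (wordVec (genericMatrix P) u w j) := by
    intro u w
    induction w with
    | nil => exact fun j => hnn j _
    | cons i w ih =>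
      intro j
      simp only [wordVec, map_sum, map_mul]
      exact Finset.sum_nonneg fun k _ => mul_nonneg (hnn _ _) (ih k)
  suffices ∃ u w, 0 < φ (wordVec (genericMatrix P) u w k) by
    obtain ⟨u, w, h⟩ := this
    refine ⟨u, w, fun h0 => ?_⟩
    rw [h0, map_zero] at h
    exact lt_irrefl _ h
  induction hk with
  | @input j u h => exact ⟨u, [], by simp only [wordVec, hone h, zero_lt_one]⟩
  | @step j i k hk h ih =>
    obtain ⟨u, w, hw⟩ := ih
    refine ⟨u, i :: w, ?_⟩
    simp only [wordVec, map_sum, map_mul]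
    refine Finset.sum_pos' (fun l _ => mul_nonneg (hnn _ _) (hpos _ _ _))
      ⟨k, Finset.mem_univ k, ?_⟩
    rw [hone h, one_mul]
    exact hw

/-- A reached state `k` is reached by a word whose vector is free of a given variable attached to
a column of `k`. -/
theorem PatternReachable.exists_wordVec_degreeOf_eq_zero {k : ι} (hk : PatternReachable P k)
    (j : ι) (i : κ) :
    ∃ u w, wordVec (genericMatrix P) u w k ≠ 0 ∧
      ∀ l, degreeOf (j, .inl (i, k)) (wordVec (genericMatrix P) u w l) = 0 := by
  by_contra! hcon
  -- If every word vector with nonzero entry `k` involved the variable, no word starting from `u`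
  -- could introduce it for the first time: it sits in column `k`, so it only ever multiplies entry
  -- `k`, which is zero as long as the variable is absent.
  obtain ⟨u, w, hw⟩ := hk.exists_wordVec_ne_zero
  suffices h : ∀ w l, degreeOf (j, .inl (i, k)) (wordVec (genericMatrix P) u w l) = 0 by
    obtain ⟨l, hl⟩ := hcon u w hw
    exact hl (h w l)
  intro w
  induction w with
  | nil =>
    intro l
    exact degreeOf_genericMatrix_of_ne P (by simp)
  | cons i' w ih =>
    intro l
    have h0 : wordVec (genericMatrix P) u w k = 0 := by
      by_contra hne
      obtain ⟨l, hl⟩ := hcon u w hne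
      exact hl (ih l)
    refine Nat.le_zero.1 ((degreeOf_sum_le _ _ _).trans (Finset.sup_le fun k' _ => ?_))
    by_cases hkk : k' = k
    · rw [hkk, h0, mul_zero, degreeOf_zero]
    · refine (degreeOf_mul_le _ _ _).trans ?_
      rw [ih, degreeOf_genericMatrix_of_ne P (by simp [Ne.symm hkk])]

/-- `q` annihilates all vectors reached along words. -/
def AnnihilatesWords {S : Type*} [CommRing S] (M : Matrix ι ((κ × ι) ⊕ υ) S) (q : ι → S) : Prop :=
  ∀ u w, ∑ j, q j * wordVec M u w j = 0

theorem AnnihilatesWords.rowStep {S : Type*} [CommRing S] {M : Matrix ι ((κ × ι) ⊕ υ) S}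
    {q : ι → S} (hq : AnnihilatesWords M q) (i : κ) : AnnihilatesWords M (rowStep M q i) :=
  fun u w => (sum_rowStep_mul_wordVec M q i u w).trans (hq u _)

theorem AnnihilatesWords.foldl {S : Type*} [CommRing S] {M : Matrix ι ((κ × ι) ⊕ υ) S}
    {q : ι → S} (hq : AnnihilatesWords M q) (w : List κ) :
    AnnihilatesWords M (w.foldl (_root_.rowStep M) q) := by
  induction w generalizing q with
  | nil => exact hq
  | cons i w ih => exact ih (hq.rowStep i)

/-- Pair `q A_i` with a word vector `v` free of the variable and with `v k ≠ 0`. The variable occurs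
among the entries of `A_i` only in the term `q j * X * v k`; as the whole sum is zero, this term has
the degree of the remaining ones, at most `D`. -/
theorem AnnihilatesWords.degreeOf_mul_X_le
    {q : ι → MvPolynomial (ι × ((κ × ι) ⊕ υ)) ℝ} (hq : AnnihilatesWords (genericMatrix P) q)
    {j k : ι} {i : κ} (hk : PatternReachable P k) (hP : P j (.inl (i, k))) {D : ℕ}
    (hD : ∀ l, degreeOf (j, .inl (i, k)) (q l) ≤ D) :
    degreeOf (j, .inl (i, k)) (q j * X (j, .inl (i, k))) ≤ D := by
  classical
  by_contra! hlt
  obtain ⟨u, w, hw, hdeg⟩ := hk.exists_wordVec_degreeOf_eq_zero j i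
  have hsum := hq u (i :: w)
  simp only [wordVec, Finset.mul_sum] at hsum
  rw [← Finset.sum_product', ← Finset.add_sum_erase _ _
    (Finset.mem_product.2 ⟨Finset.mem_univ (j, k).1, Finset.mem_univ (j, k).2⟩)] at hsum
  have hmain : degreeOf (j, .inl (i, k))
      (q j * (genericMatrix P j (.inl (i, k)) * wordVec (genericMatrix P) u w k)) =
      degreeOf (j, .inl (i, k)) (q j * X (j, .inl (i, k))) := by
    have hX : genericMatrix P j (.inl (i, k)) = X (j, .inl (i, k)) := by simp [genericMatrix, hP]
    -- Degrees are additive only for nonzero factors; the assumed degree above `D` excludes zero.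
    have hne : q j * X (j, .inl (i, k)) ≠ 0 := by
      intro h0
      rw [h0, degreeOf_zero] at hlt
      exact absurd hlt (Nat.not_lt_zero _)
    rw [hX, ← mul_assoc, degreeOf_mul_eq hne hw, hdeg, add_zero]
  have hrest : degreeOf (j, .inl (i, k))
      (∑ x ∈ (Finset.univ ×ˢ Finset.univ).erase (j, k),
        q x.1 * (genericMatrix P x.1 (.inl (i, x.2)) * wordVec (genericMatrix P) u w x.2)) ≤ D := by
    refine (degreeOf_sum_le _ _ _).trans (Finset.sup_le fun x hx => ?_)
    refine (degreeOf_mul_le _ _ _).trans ?_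
    have h1 : degreeOf (j, .inl (i, k)) (genericMatrix P x.1 (.inl (i, x.2))) = 0 := by
      refine degreeOf_genericMatrix_of_ne P fun h => Finset.ne_of_mem_erase hx ?_
      simp only [Prod.mk.injEq, Sum.inl.injEq, true_and] at h
      exact Prod.ext h.1.symm h.2.symm
    have h2 := degreeOf_mul_le (j, .inl (i, k)) (genericMatrix P x.1 (.inl (i, x.2)))
      (wordVec (genericMatrix P) u w x.2)
    rw [h1, hdeg, add_zero] at h2
    have := hD x.1
    omega
  rw [eq_neg_of_add_eq_zero_left hsum, degreeOf_neg] at hmain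
  omega

/-- Only multiplication by the entry `e` itself could raise the degree in `e`, and there
annihilation forbids it. -/
theorem AnnihilatesWords.degreeOf_rowStep_le
    {q : ι → MvPolynomial (ι × ((κ × ι) ⊕ υ)) ℝ} (hq : AnnihilatesWords (genericMatrix P) q)
    (hreach : ∀ k, PatternReachable P k) {e : ι × ((κ × ι) ⊕ υ)} {D : ℕ}
    (hD : ∀ l, degreeOf e (q l) ≤ D) (i : κ) (k : ι) :
    degreeOf e (_root_.rowStep (genericMatrix P) q i k) ≤ D := by
  classical
  refine (degreeOf_sum_le _ _ _).trans (Finset.sup_le fun l _ => ?_)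
  by_cases he : e = (l, .inl (i, k))
  · subst he
    by_cases hP : P l (.inl (i, k))
    · have hX : genericMatrix P l (.inl (i, k)) = X (l, .inl (i, k)) := by
        simp [genericMatrix, hP]
      rw [hX]
      exact hq.degreeOf_mul_X_le (hreach k) hP hD
    · simp [genericMatrix, hP]
  · refine (degreeOf_mul_le _ _ _).trans ?_
    rw [degreeOf_genericMatrix_of_ne P he, add_zero]
    exact hD l

/-- Multiplication by the generic matrix raises the order of a row vector. -/
theorem le_degree_of_mem_support_foldl_rowStep
    {q : ι → MvPolynomial (ι × ((κ × ι) ⊕ υ)) ℝ} {r : ℕ}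
    (hq : ∀ l, ∀ s ∈ (q l).support, r ≤ s.degree) (w : List κ) :
    ∀ l, ∀ s ∈ (w.foldl (rowStep (genericMatrix P)) q l).support, r + w.length ≤ s.degree := by
  classical
  induction w generalizing q r with
  | nil => exact hq
  | cons i w ih =>
    -- Entries of the generic matrix are zero or single variables, so each step adds exactly one to
    -- the degree of every surviving monomial.
    have := @ih (rowStep (genericMatrix P) q i) (r + 1) ?_
    · simpa [add_assoc, add_comm 1] using this
    · intro k s hs
      obtain ⟨l, -, hl⟩ := Finset.mem_biUnion.1 (support_sum hs)
      by_cases hP : P l (.inl (i, k))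
      · have hX : genericMatrix P l (.inl (i, k)) = X (l, .inl (i, k)) := by
          simp [genericMatrix, hP]
        rw [hX, support_mul_X, Finset.mem_map] at hl
        obtain ⟨t, ht, rfl⟩ := hl
        simpa using hq l t ht
      · simp [genericMatrix, hP] at hl

/-- The degree in each variable stays bounded along all words while the order grows with the length;
beyond the sum of the bounds no monomial is left. -/
theorem AnnihilatesWords.exists_foldl_rowStep_eq_zero [Fintype κ] [Fintype υ]
    {q : ι → MvPolynomial (ι × ((κ × ι) ⊕ υ)) ℝ} (hq : AnnihilatesWords (genericMatrix P) q)
    (hreach : ∀ k, PatternReachable P k) :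
    ∃ r, ∀ w : List κ, w.length = r → w.foldl (_root_.rowStep (genericMatrix P)) q = 0 := by
  let D : ι × ((κ × ι) ⊕ υ) → ℕ := fun e => Finset.univ.sup fun l => degreeOf e (q l)
  have hD : ∀ w : List κ, ∀ e l,
      degreeOf e (w.foldl (_root_.rowStep (genericMatrix P)) q l) ≤ D e := by
    intro w
    induction w using List.reverseRecOn with
    | nil => exact fun e l => Finset.le_sup (f := fun l => degreeOf e (q l)) (Finset.mem_univ l)
    | append_singleton w i ih =>
      intro e l
      rw [List.foldl_append]
      exact (hq.foldl w).degreeOf_rowStep_le hreach (ih e) i l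
  refine ⟨∑ e, D e + 1, fun w hw => funext fun l => ?_⟩
  rw [Pi.zero_apply, ← support_eq_empty, Finset.eq_empty_iff_forall_notMem]
  intro s hs
  have h1 := le_degree_of_mem_support_foldl_rowStep (P := P) (q := q) (r := 0)
    (fun _ _ _ => Nat.zero_le _) w l s hs
  have h2 : s.degree ≤ ∑ e, D e := by
    rw [Finsupp.degree_eq_sum]
    exact Finset.sum_le_sum fun e _ => (monomial_le_degreeOf e hs).trans (hD w e l)
  omega

/-- If the pattern is input-reachable and its generic realization has trivial left kernel, then the
generic realization has no annihilator. -/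
theorem AnnihilatesWords.eq_zero [Fintype κ] [Fintype υ]
    {q : ι → MvPolynomial (ι × ((κ × ι) ⊕ υ)) ℝ} (hq : AnnihilatesWords (genericMatrix P) q)
    (hreach : ∀ k, PatternReachable P k)
    (hker : ∀ p : ι → MvPolynomial (ι × ((κ × ι) ⊕ υ)) ℝ,
      (∀ c, ∑ j, p j * genericMatrix P j c = 0) → p = 0) : q = 0 := by
  obtain ⟨r, hr⟩ := hq.exists_foldl_rowStep_eq_zero hreach
  induction r generalizing q with
  | zero => exact hr [] rfl
  | succ r ih =>
    -- The induction hypothesis makes every `q A_i` vanish; the empty words say that `q` kills the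
    -- input columns.
    refine hker q ?_
    rintro (⟨i, k⟩ | u)
    · have := ih (hq.rowStep i) fun w hw => hr (i :: w) (by simp [hw])
      exact congrFun this k
    · exact hq u []

theorem genericMatrix_ker_eq_bot {γ : Type*} [DecidableEq ι] {P : StructuredMatrix ι γ}
    {M : Matrix ι γ ℝ} (hM : P.IsRealization M) {g : ι → γ}
    (hg : (Matrix.of fun i l => M i (g l)).det ≠ 0) (p : ι → MvPolynomial (ι × γ) ℝ)
    (hp : ∀ c, ∑ j, p j * genericMatrix P j c = 0) : p = 0 := by
  refine Matrix.eq_zero_of_vecMul_eq_zero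
    (M := Matrix.of fun i l => genericMatrix P i (g l)) (fun h0 => hg ?_) (funext fun l => hp (g l))
  have h := RingHom.map_det (eval fun e : ι × γ => M e.1 e.2)
    (Matrix.of fun i l => genericMatrix P i (g l))
  rw [h0, map_zero] at h
  refine Eq.trans ?_ h.symm
  congr 1
  ext i l
  exact (congrFun (congrFun (genericMatrix_eval P hM) i) (g l)).symm

/-- A realization whose word vectors span the state space. -/
theorem exists_realization_span_wordVec_eq_top [DecidableEq ι] [Fintype κ] [Fintype υ]
    (hreach : ∀ k, PatternReachable P k)
    {M : Matrix ι ((κ × ι) ⊕ υ) ℝ} (hM : P.IsRealization M) {g : ι → (κ × ι) ⊕ υ}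
    (hg : (Matrix.of fun i l => M i (g l)).det ≠ 0) :
    ∃ M' : Matrix ι ((κ × ι) ⊕ υ) ℝ, P.IsRealization M' ∧
      ∀ W : Submodule ℝ (ι → ℝ), (∀ u w, wordVec M' u w ∈ W) → W = ⊤ := by
  obtain ⟨h, hdet⟩ := exists_det_ne_zero_of_annihilator
    (fun c : υ × List κ => wordVec (genericMatrix P) c.1 c.2) fun q hq =>
      AnnihilatesWords.eq_zero (fun u w => hq (u, w)) hreach (genericMatrix_ker_eq_bot hM hg)
  obtain ⟨x, hx⟩ : ∃ x : ι × ((κ × ι) ⊕ υ) → ℝ,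
      eval x (Matrix.of fun i l => wordVec (genericMatrix P) (h l).1 (h l).2 i).det ≠ 0 := by
    -- A polynomial that vanishes at all real points is zero.
    by_contra! hcon
    exact hdet (MvPolynomial.funext fun x => by rw [hcon x, map_zero])
  refine ⟨(genericMatrix P).map (eval x), isRealization_eval_genericMatrix P x, fun W hW => ?_⟩
  by_contra hne
  obtain ⟨q, hq0, hq⟩ := exists_annihilator_of_ne_top W hne
  rw [RingHom.map_det] at hx
  refine hq0 (Matrix.eq_zero_of_vecMul_eq_zero hx (funext fun l => ?_))
  have := hq _ (hW (h l).1 (h l).2)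
  simp only [wordVec_map] at this
  exact this

end Generic

/-! ### Walks and paths -/

section WalkLemmas

variable {n N : ℕ} {m : Fin N → ℕ} {E : Set (ColoredEdge n N m)} {u v w x : Vertex n N m}
  {es fs : List (ColoredEdge n N m)}

theorem IsWalk.append (h : IsWalk E u es v) (h' : IsWalk E v fs w) :
    IsWalk E u (es ++ fs) w := by
  induction es generalizing u with
  | nil => exact (show u = v from h) ▸ h'
  | cons e es ih => exact ⟨h.1, h.2.1, ih h.2.2⟩

theorem IsWalk.of_closed {p : Vertex n N m → Prop} (hp : ∀ e ∈ E, p e.tail → p e.head)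
    (h : IsWalk E v es w) (hv : p v) : p w := by
  induction es generalizing v with
  | nil => exact (show v = w from h) ▸ hv
  | cons e es ih => exact ih h.2.2 (hp e h.1 (h.2.1 ▸ hv))

theorem IsPath.exists_suffix (h : IsPath E u es w) (hx : x ∈ u :: es.map ColoredEdge.head) :
    ∃ fs, IsPath E x fs w := by
  induction es generalizing u with
  | nil => exact ⟨[], by simpa using (List.mem_singleton.1 hx) ▸ h⟩
  | cons e es ih =>
    rcases List.mem_cons.1 hx with rfl | hx
    · exact ⟨_, h⟩
    · exact ih ⟨h.1.2.2, (List.nodup_cons.1 h.2).2⟩ hx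

theorem IsWalk.exists_isPath (h : IsWalk E v es w) : ∃ fs, IsPath E v fs w := by
  induction es generalizing v with
  | nil => exact ⟨[], h, List.nodup_singleton v⟩
  | cons e es ih =>
    obtain ⟨fs, hfs⟩ := ih h.2.2
    by_cases hv : v ∈ e.head :: fs.map ColoredEdge.head
    · exact hfs.exists_suffix hv
    · exact ⟨e :: fs, ⟨h.1, h.2.1, hfs.1⟩, List.nodup_cons.2 ⟨hv, hfs.2⟩⟩

theorem IsWalk.edge_mem (h : IsWalk E v es w) {e : ColoredEdge n N m} (he : e ∈ es) : e ∈ E := by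
  induction es generalizing v with
  | nil => exact absurd he List.not_mem_nil
  | cons a es ih =>
    rcases List.mem_cons.1 he with rfl | he
    · exact h.1
    · exact ih h.2.2 he

theorem IsWalk.tail_eq_or (h : IsWalk E v es w) {e : ColoredEdge n N m} (he : e ∈ es) :
    e.tail = v ∨ ∃ a ∈ es, a.head = e.tail := by
  induction es generalizing v with
  | nil => exact absurd he List.not_mem_nil
  | cons a es ih =>
    rcases List.mem_cons.1 he with rfl | he
    · exact .inl h.2.1
    · right
      rcases ih h.2.2 he with h' | ⟨b, hb, hb'⟩
      · exact ⟨a, List.mem_cons_self, h'.symm⟩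
      · exact ⟨b, List.mem_cons_of_mem _ hb, hb'⟩

theorem IsWalk.exists_head_eq (h : IsWalk E v es w) (hne : es ≠ []) :
    ∃ e ∈ es, e.head = w := by
  induction es generalizing v with
  | nil => exact absurd rfl hne
  | cons a es ih =>
    by_cases hes : es = []
    · subst hes
      exact ⟨a, List.mem_cons_self, h.2.2⟩
    · obtain ⟨e, he, hew⟩ := ih h.2.2 hes
      exact ⟨e, List.mem_cons_of_mem _ he, hew⟩

end WalkLemmas

/-! ### Input-reachability -/

namespace StructuredSystem

variable {n N : ℕ} {m : Fin N → ℕ} {P : StructuredSystem n N m}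

theorem InputReachable.of_input {i : Fin N} {k : Fin (m i)} {c : Fin N} {j : Fin n}
    (h : (⟨.input i k, c, .state j⟩ : ColoredEdge n N m) ∈ P.edges) : P.InputReachable j :=
  ⟨i, k, IsWalk.exists_isPath (es := [⟨.input i k, c, .state j⟩]) ⟨h, rfl, rfl⟩⟩

theorem InputReachable.step {k j : Fin n} (hk : P.InputReachable k) {c : Fin N}
    (h : (⟨.state k, c, .state j⟩ : ColoredEdge n N m) ∈ P.edges) : P.InputReachable j := by
  obtain ⟨i, l, es, hes⟩ := hk
  exact ⟨i, l, (hes.1.append (fs := [⟨.state k, c, .state j⟩]) ⟨h, rfl, rfl⟩).exists_isPath⟩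

/-- The edge with head `x_j` that corresponds to the entry in row `j` and column `c` of the
concatenated matrix. -/
def columnEdge (j : Fin n) : (Fin N × Fin n) ⊕ (Σ i : Fin N, Fin (m i)) → ColoredEdge n N m
  | .inl p => ⟨.state p.2, p.1, .state j⟩
  | .inr q => ⟨.input q.1 q.2, q.1, .state j⟩

theorem columnEdge_head (j : Fin n) (c : (Fin N × Fin n) ⊕ (Σ i : Fin N, Fin (m i))) :
    (columnEdge j c).head = .state j := by
  cases c <;> rfl

theorem columnEdge_injective {j l : Fin n} {c d : (Fin N × Fin n) ⊕ (Σ i : Fin N, Fin (m i))}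
    (ht : (columnEdge j c).tail = (columnEdge l d).tail)
    (hc : (columnEdge j c).color = (columnEdge l d).color) : c = d := by
  rcases c with ⟨i, k⟩ | ⟨i, k⟩ <;> rcases d with ⟨i', k'⟩ | ⟨i', k'⟩ <;>
    simp_all [columnEdge]

theorem mem_edges_iff {e : ColoredEdge n N m} :
    e ∈ P.edges ↔ ∃ j c, P.concat j c ∧ e = columnEdge j c := by
  constructor
  · rintro (⟨i, j, k, h, rfl⟩ | ⟨i, j, k, h, rfl⟩)
    · exact ⟨j, .inl (i, k), h, rfl⟩
    · exact ⟨j, .inr ⟨i, k⟩, h, rfl⟩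
  · rintro ⟨j, ⟨i, k⟩ | ⟨i, k⟩, h, rfl⟩
    · exact .inl ⟨i, j, k, h, rfl⟩
    · exact .inr ⟨i, j, k, h, rfl⟩

theorem columnEdge_mem {j : Fin n} {c : (Fin N × Fin n) ⊕ (Σ i : Fin N, Fin (m i))}
    (h : P.concat j c) : columnEdge j c ∈ P.edges :=
  mem_edges_iff.2 ⟨j, c, h, rfl⟩

theorem InputReachable.patternReachable {j : Fin n} (h : P.InputReachable j) :
    PatternReachable P.concat j := by
  obtain ⟨i, k, es, hes⟩ := h
  -- The propagated property is vacuous at the initial input vertex.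
  refine hes.1.of_closed (p := fun v => ∀ l, v = .state l → PatternReachable P.concat l) ?_
    (fun l hl => by simp at hl) j rfl
  intro e he htail l hl
  obtain ⟨j, ⟨i, k⟩ | q, h, rfl⟩ := mem_edges_iff.1 he
  · obtain rfl : j = l := Vertex.state.inj hl
    exact .step (htail k rfl) h
  · obtain rfl : j = l := Vertex.state.inj hl
    exact .input h

/-! ### Generic rank and matchings -/

theorem grank_eq_of_span {M : Matrix (Fin n) ((Fin N × Fin n) ⊕ (Σ i : Fin N, Fin (m i))) ℝ}
    (hM : P.concat.IsRealization M) (hspan : Submodule.span ℝ (range M.col) = ⊤) :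
    P.concat.grank = n := by
  have hn : M.rank = n := by
    rw [Matrix.rank_eq_finrank_span_cols, hspan, finrank_top, Module.finrank_fin_fun]
  refine le_antisymm ?_ (P.concat.isGreatest_grank.2 ⟨M, hM, hn⟩)
  obtain ⟨M', -, h⟩ := P.concat.isGreatest_grank.1
  exact h.symm.trans_le (M'.rank_le_card_height.trans_eq (Fintype.card_fin n))

theorem exists_det_ne_zero_of_grank_eq (h : P.concat.grank = n) :
    ∃ M, P.concat.IsRealization M ∧
      ∃ g : Fin n → (Fin N × Fin n) ⊕ (Σ i : Fin N, Fin (m i)),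
        (Matrix.of fun i l => M i (g l)).det ≠ 0 := by
  obtain ⟨M, hM, hr⟩ := P.concat.isGreatest_grank.1
  refine ⟨M, hM, exists_det_ne_zero_of_span_eq_top M.col ?_⟩
  refine Submodule.eq_top_of_finrank_eq ?_
  rw [← Matrix.rank_eq_finrank_span_cols, hr, h, Module.finrank_fin_fun]

/-- The generic rank is full if and only if the rows can be matched to distinct columns. -/
theorem grank_eq_iff_exists_matching :
    P.concat.grank = n ↔ ∃ g : Fin n → (Fin N × Fin n) ⊕ (Σ i : Fin N, Fin (m i)),
      Function.Injective g ∧ ∀ j, P.concat j (g j) := by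
  classical
  constructor
  · intro h
    obtain ⟨M, hM, g, hg⟩ := exists_det_ne_zero_of_grank_eq h
    have hinj : Function.Injective g := fun a b hab => by
      by_contra hne
      exact hg (Matrix.det_zero_of_column_eq hne fun i => by simp [hab])
    rw [Matrix.det_apply] at hg
    obtain ⟨τ, -, hτ⟩ := Finset.exists_ne_zero_of_sum_ne_zero hg
    -- The nonzero term of `τ` is a product of the entries in row `τ l` and column `g l`.
    refine ⟨g ∘ τ.symm, hinj.comp τ.symm.injective, fun j => ?_⟩
    by_contra hP
    refine hτ ?_
    rw [Finset.prod_eq_zero (Finset.mem_univ (τ.symm j)), smul_zero]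
    simpa using hM j _ hP
  · rintro ⟨g, hinj, hg⟩
    -- By injectivity of `g`, column `g j` of this 0-1 realization is the `j`-th unit vector.
    let M : Matrix (Fin n) ((Fin N × Fin n) ⊕ (Σ i : Fin N, Fin (m i))) ℝ :=
      fun j c => if c = g j then 1 else 0
    refine grank_eq_of_span (M := M) (fun j c h => if_neg fun hc : c = g j => h (hc ▸ hg j)) ?_
    rw [eq_top_iff, ← (Pi.basisFun ℝ (Fin n)).span_eq]
    refine Submodule.span_mono ?_
    rintro _ ⟨j, rfl⟩
    refine ⟨g j, ?_⟩
    ext l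
    have hM : M.col (g j) l = if g j = g l then 1 else 0 := rfl
    rw [hM, Pi.basisFun_apply, Pi.single_apply]
    simp only [hinj.eq_iff, eq_comm]

end StructuredSystem

/-! ### Functional graphs -/

section Parent

variable {n N : ℕ} {m : Fin N → ℕ}

/-- The predecessor of a vertex in the graph with the edges `e j`; input vertices are fixed. -/
def parent (e : Fin n → ColoredEdge n N m) : Vertex n N m → Vertex n N m
  | .state j => (e j).tail
  | .input i k => .input i k

/-- The edges `e j` traversed on the way from the `L`-th predecessor of a vertex to the vertex. -/
def backWalk (e : Fin n → ColoredEdge n N m) : ℕ → Vertex n N m → List (ColoredEdge n N m)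
  | 0, _ => []
  | _ + 1, .input _ _ => []
  | L + 1, .state j => backWalk e L (e j).tail ++ [e j]

variable {e : Fin n → ColoredEdge n N m} {E : Set (ColoredEdge n N m)}

theorem parent_iterate_input (L : ℕ) (i : Fin N) (k : Fin (m i)) :
    (parent e)^[L] (.input i k) = .input i k :=
  Function.iterate_fixed rfl L

theorem isWalk_backWalk (he : ∀ j, (e j).head = .state j) (L : ℕ) (v : Vertex n N m)
    (hE : ∀ a < L, ∀ j, (parent e)^[a] v = .state j → e j ∈ E) :
    IsWalk E ((parent e)^[L] v) (backWalk e L v) v := by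
  induction L generalizing v with
  | zero => rfl
  | succ L ih =>
    cases v with
    | input i k => exact parent_iterate_input (L + 1) i k
    | state j =>
      refine (ih (e j).tail fun a ha l hl => hE (a + 1) (by omega) l hl).append
        ⟨hE 0 (by omega) j rfl, rfl, he j⟩

theorem mem_map_head_backWalk (he : ∀ j, (e j).head = .state j) (L : ℕ) {v x : Vertex n N m}
    (h : x ∈ (backWalk e L v).map ColoredEdge.head) : ∃ a < L, (parent e)^[a] v = x := by
  induction L generalizing v with
  | zero => simp [backWalk] at h
  | succ L ih =>
    cases v with
    | input i k => simp [backWalk] at h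
    | state j =>
      simp only [backWalk, List.map_append, List.mem_append, List.map_cons, List.map_nil,
        List.mem_singleton, he] at h
      rcases h with h | rfl
      · obtain ⟨a, ha, hx⟩ := ih h
        exact ⟨a + 1, by omega, hx⟩
      · exact ⟨0, by omega, rfl⟩

theorem nodup_map_head_backWalk (he : ∀ j, (e j).head = .state j)
    (L : ℕ) {v : Vertex n N m}
    (hinj : InjOn (fun a => (parent e)^[a] v) (Iio L)) :
    ((backWalk e L v).map ColoredEdge.head).Nodup := by
  induction L generalizing v with
  | zero => simp [backWalk]
  | succ L ih =>
    cases v with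
    | input i k => simp [backWalk]
    | state j =>
      simp only [backWalk, List.map_append, List.map_cons, List.map_nil, he]
      refine List.nodup_append.2 ⟨ih fun a ha b hb hab => ?_, List.nodup_singleton _, ?_⟩
      · have := hinj (mem_Iio.2 (Nat.succ_lt_succ ha)) (mem_Iio.2 (Nat.succ_lt_succ hb)) hab
        omega
      · intro x hx y hy hxy
        obtain rfl := List.mem_singleton.1 hy
        obtain ⟨a, ha, hax⟩ := mem_map_head_backWalk he L hx
        have := hinj (mem_Iio.2 (Nat.succ_lt_succ ha)) (mem_Iio.2 L.succ_pos) (hax.trans hxy)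
        omega

/-- A set of states that contains the predecessors of its elements contains a cycle. -/
theorem exists_isCycle (he : ∀ j, (e j).head = .state j)
    {U : Set (Fin n)} {j₀ : Fin n} (hj₀ : j₀ ∈ U)
    (hU : ∀ j ∈ U, e j ∈ E ∧ ∃ k ∈ U, (e j).tail = .state k) : ∃ C, IsCycle E C := by
  have hit : ∀ a, ∃ k ∈ U, (parent e)^[a] (.state j₀) = .state k := by
    intro a
    induction a with
    | zero => exact ⟨j₀, hj₀, rfl⟩
    | succ a ih =>
      obtain ⟨k, hk, hak⟩ := ih
      obtain ⟨l, hl, hkl⟩ := (hU k hk).2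
      exact ⟨l, hl, by rw [Function.iterate_succ_apply', hak, ← hkl]; rfl⟩
  choose s hsU hs using hit
  -- The backward orbit stays in a finite set, so it repeats.
  obtain ⟨a, b, hab, hsab⟩ : ∃ a b, a < b ∧ s a = s b := by
    obtain ⟨a, b, hne, h⟩ := Finite.exists_ne_map_eq_of_infinite s
    rcases lt_or_gt_of_ne hne with hlt | hlt
    · exact ⟨a, b, hlt, h⟩
    · exact ⟨b, a, hlt, h.symm⟩
  set x : Vertex n N m := .state (s a) with hx
  have hper : Function.IsPeriodicPt (parent e) (b - a) x := by
    show (parent e)^[b - a] x = x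
    rw [hx, ← hs a, ← Function.iterate_add_apply, Nat.sub_add_cancel hab.le, hs, hs, hsab]
  have hpos : 0 < Function.minimalPeriod (parent e) x :=
    hper.minimalPeriod_pos (by omega)
  -- Taking the minimal period makes the heads distinct.
  refine ⟨_, x, backWalk e (Function.minimalPeriod (parent e) x) x, ?_, ?_, ?_, rfl⟩
  · obtain ⟨L, hL⟩ := Nat.exists_eq_succ_of_ne_zero hpos.ne'
    rw [hL, hx]
    simp [backWalk]
  · have := isWalk_backWalk (E := E) he (Function.minimalPeriod (parent e) x) x ?_
    · rwa [Function.iterate_minimalPeriod] at this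
    · intro c _ j hj
      rw [hx, ← hs a, ← Function.iterate_add_apply, hs] at hj
      exact Vertex.state.inj hj ▸ (hU _ (hsU _)).1
  · exact nodup_map_head_backWalk he _ Function.iterate_injOn_Iio_minimalPeriod

theorem parent_head (he : ∀ j, (e j).head = .state j)
    (hE : ∀ a ∈ E, ∃ j, a = e j) {a : ColoredEdge n N m} (ha : a ∈ E) :
    parent e a.head = a.tail := by
  obtain ⟨j, rfl⟩ := hE a ha
  rw [he]
  rfl

theorem IsWalk.iterate_parent (he : ∀ j, (e j).head = .state j)
    (hE : ∀ a ∈ E, ∃ j, a = e j) {u w : Vertex n N m}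
    {es : List (ColoredEdge n N m)} (h : IsWalk E u es w) : (parent e)^[es.length] w = u := by
  induction es generalizing u with
  | nil => exact (show u = w from h).symm
  | cons a es ih =>
    rw [List.length_cons, Function.iterate_succ_apply', ih h.2.2, parent_head he hE h.1, h.2.1]

theorem IsWalk.exists_iterate_eq_head (he : ∀ j, (e j).head = .state j)
    (hE : ∀ a ∈ E, ∃ j, a = e j) {u w : Vertex n N m}
    {es : List (ColoredEdge n N m)} (h : IsWalk E u es w) {a : ColoredEdge n N m} (ha : a ∈ es) :
    ∃ c, (parent e)^[c] w = a.head := by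
  induction es generalizing u with
  | nil => exact absurd ha List.not_mem_nil
  | cons b es ih =>
    rcases List.mem_cons.1 ha with rfl | ha
    · exact ⟨_, h.2.2.iterate_parent he hE⟩
    · exact ih h.2.2 ha

theorem IsWalk.exists_mem_head_eq_iterate (he : ∀ j, (e j).head = .state j)
    (hE : ∀ a ∈ E, ∃ j, a = e j) {v : Vertex n N m}
    {es : List (ColoredEdge n N m)} (h : IsWalk E v es v) (hne : es ≠ []) (c : ℕ) :
    ∃ a ∈ es, a.head = (parent e)^[c] v := by
  induction c with
  | zero => exact h.exists_head_eq hne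
  | succ c ih =>
    obtain ⟨a, ha, hac⟩ := ih
    rw [Function.iterate_succ_apply', ← hac, parent_head he hE (h.edge_mem ha)]
    rcases h.tail_eq_or ha with h' | ⟨b, hb, hb'⟩
    · rw [h']
      exact h.exists_head_eq hne
    · exact ⟨b, hb, hb'⟩

/-- A functional graph has at most one cycle in every component. -/
theorem closedWalk_subset_of_iterate_eq (he : ∀ j, (e j).head = .state j)
    (hE : ∀ a ∈ E, ∃ j, a = e j) {v w : Vertex n N m}
    {es fs : List (ColoredEdge n N m)} (h : IsWalk E v es v) (hes : es ≠ [])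
    (h' : IsWalk E w fs w) (hfs : fs ≠ []) {a b : ℕ}
    (hab : (parent e)^[a] v = (parent e)^[b] w) {x : ColoredEdge n N m} (hx : x ∈ es) :
    x ∈ fs := by
  obtain ⟨c, hc⟩ := h.exists_iterate_eq_head he hE hx
  have hpos : 0 < es.length := List.length_pos_iff.2 hes
  -- Going back `a` steps reaches the orbit of `w`; completing to a multiple of the period returns
  -- to `v`. So `v`, and with it every head of `es`, lies on the backward orbit of `w`, whose
  -- vertices are heads of `fs`.
  have hper : (parent e)^[es.length * a] v = v := by
    rw [Function.iterate_mul]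
    exact Function.iterate_fixed (h.iterate_parent he hE) a
  have hle : a ≤ es.length * a := Nat.le_mul_of_pos_left a hpos
  rw [← Nat.sub_add_cancel hle, Function.iterate_add_apply, hab, ← Function.iterate_add_apply]
    at hper
  rw [← hper, ← Function.iterate_add_apply] at hc
  obtain ⟨y, hy, hyx⟩ := h'.exists_mem_head_eq_iterate he hE hfs
    (c + (es.length * a - a + b))
  obtain ⟨j, rfl⟩ := hE x (h.edge_mem hx)
  obtain ⟨l, rfl⟩ := hE y (h'.edge_mem hy)
  rw [hc, he, he] at hyx
  exact Vertex.state.inj hyx ▸ hy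

/-- Two vertices are in the same component of the graph with the edges `e j`. -/
def SameComponent (e : Fin n → ColoredEdge n N m) (v w : Vertex n N m) : Prop :=
  ∃ a b, (parent e)^[a] v = (parent e)^[b] w

theorem SameComponent.refl (v : Vertex n N m) : SameComponent e v v := ⟨0, 0, rfl⟩

theorem SameComponent.symm {v w : Vertex n N m} (h : SameComponent e v w) :
    SameComponent e w v :=
  let ⟨a, b, h⟩ := h
  ⟨b, a, h.symm⟩

theorem SameComponent.trans {u v w : Vertex n N m} (h : SameComponent e u v)
    (h' : SameComponent e v w) : SameComponent e u w := by
  obtain ⟨a, b, hab⟩ := h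
  obtain ⟨c, d, hcd⟩ := h'
  refine ⟨c + a, b + d, ?_⟩
  rw [Function.iterate_add_apply, hab, ← Function.iterate_add_apply, add_comm,
    Function.iterate_add_apply, hcd, ← Function.iterate_add_apply]

theorem SameComponent.parent {v w : Vertex n N m} (h : SameComponent e v w) :
    SameComponent e v (parent e w) :=
  h.trans ⟨1, 0, rfl⟩

end Parent

/-! ### Generalized cactus configurations -/

namespace StructuredSystem

variable {n N : ℕ} {m : Fin N → ℕ} {P : StructuredSystem n N m}

/-- The component of `v` in the graph with the edges `e j`. -/
def component {e : Fin n → ColoredEdge n N m} (he : ∀ j, (e j).head = .state j)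
    (hP : ∀ j, e j ∈ P.edges) (v : Vertex n N m) : P.Subgraph where
  verts := {w | SameComponent e v w}
  edges := {a | ∃ j, a = e j ∧ SameComponent e v (.state j)}
  edges_subset := by
    rintro _ ⟨j, rfl, -⟩
    exact hP j
  tail_mem := by
    rintro _ ⟨j, rfl, h⟩
    exact h.parent
  head_mem := by
    rintro _ ⟨j, rfl, h⟩
    show SameComponent e v (e j).head
    rwa [he]

/-- The pieces are the components of the graph of matching edges. Injectivity of the matching gives
S-disjointness, since tail and color determine the column. -/
theorem isCoveredByGeneralizedCactus_of_matching
    {g : Fin n → (Fin N × Fin n) ⊕ (Σ i : Fin N, Fin (m i))} (hinj : Function.Injective g)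
    (hg : ∀ j, P.concat j (g j)) (hreach : ∀ j, P.InputReachable j) :
    P.IsCoveredByGeneralizedCactus univ := by
  let e : Fin n → ColoredEdge n N m := fun j => columnEdge j (g j)
  have he : ∀ j, (e j).head = .state j := fun j => columnEdge_head j (g j)
  have heinj : ∀ {j l}, (e j).head = (e l).head → j = l := fun {j l} h => by
    rw [he, he] at h
    exact Vertex.state.inj h
  have hP : ∀ j, e j ∈ P.edges := fun j => columnEdge_mem (hg j)
  have hE : ∀ v, ∀ a ∈ (component he hP v).edges, ∃ j, a = e j := by
    rintro v _ ⟨j, rfl, -⟩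
    exact ⟨j, rfl⟩
  refine ⟨range fun j => component he hP (.state j), ?_, ?_, ?_⟩
  · rintro _ ⟨j₀, rfl⟩
    have hin : ∀ j : Fin n, .state j ∈ (component he hP (.state j₀)).verts →
        ∃! a, a ∈ (component he hP (.state j₀)).edges ∧ a.head = .state j := by
      intro j hj
      refine ⟨e j, ⟨⟨j, rfl, hj⟩, he j⟩, ?_⟩
      rintro _ ⟨⟨l, rfl, -⟩, hl⟩
      rw [heinj (hl.trans (he j).symm)]
    have hS : SDisjoint (component he hP (.state j₀)).edges := by
      rintro _ ⟨j, rfl, -⟩ _ ⟨l, rfl, -⟩ hne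
      refine ⟨fun h => hne (by rw [heinj h]), fun ht hc => hne ?_⟩
      rw [hinj (columnEdge_injective ht hc)]
    -- Inputs are fixed by `parent`, so a component with an input has all its backward orbits ending
    -- there: no second input and no cycle.
    by_cases hinp : ∃ i k, .input i k ∈ (component he hP (.state j₀)).verts
    · obtain ⟨i, k, hik⟩ := hinp
      refine .inl ⟨⟨.input i k, ⟨hik, i, k, rfl⟩, ?_⟩, ?_, hin, hS⟩
      · rintro _ ⟨hw, i', k', rfl⟩
        obtain ⟨a, b, hab⟩ := (SameComponent.symm hik).trans hw
        rw [parent_iterate_input, parent_iterate_input] at hab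
        exact hab.symm
      · rintro C ⟨v, es, hes, hw, -, -⟩
        obtain ⟨x, hx, hxv⟩ := hw.exists_head_eq hes
        have hv : SameComponent e (.state j₀) v :=
          hxv ▸ (component he hP (.state j₀)).head_mem x (hw.edge_mem hx)
        obtain ⟨a, b, hab⟩ := (SameComponent.symm hik).trans hv
        obtain ⟨y, hy, hyb⟩ := hw.exists_mem_head_eq_iterate he (hE _) hes b
        obtain ⟨l, rfl⟩ := hE _ y (hw.edge_mem hy)
        rw [he, ← hab, parent_iterate_input] at hyb
        cases hyb
    · have hno : ∀ i k, .input i k ∉ (component he hP (.state j₀)).verts :=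
        fun i k h => hinp ⟨i, k, h⟩
      refine .inr ⟨hno, ?_, fun j _ => hreach j, hin, hS⟩
      obtain ⟨C, hC⟩ : ∃ C, IsCycle (component he hP (.state j₀)).edges C := by
        refine exists_isCycle he (U := {j | SameComponent e (.state j₀) (.state j)})
          (SameComponent.refl _) fun j hj => ⟨⟨j, rfl, hj⟩, ?_⟩
        have hpar : SameComponent e (.state j₀) (e j).tail := SameComponent.parent hj
        rcases htail : (e j).tail with k | ⟨i, k⟩
        · exact ⟨k, (htail ▸ hpar : SameComponent e (.state j₀) (.state k)), rfl⟩
        · exact absurd (htail ▸ hpar) (hno i k)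
      refine ⟨C, hC, fun C' hC' => ?_⟩
      obtain ⟨v, es, hes, hw, -, rfl⟩ := hC
      obtain ⟨v', es', hes', hw', -, rfl⟩ := hC'
      have hmem : ∀ {v es}, es ≠ [] → IsWalk (component he hP (.state j₀)).edges v es v →
          SameComponent e (.state j₀) v := by
        intro v es hes hw
        obtain ⟨x, hx, hxv⟩ := hw.exists_head_eq hes
        exact hxv ▸ (component he hP (.state j₀)).head_mem x (hw.edge_mem hx)
      obtain ⟨a, b, hab⟩ := (hmem hes hw).symm.trans (hmem hes' hw')
      ext x
      exact ⟨fun hx => closedWalk_subset_of_iterate_eq he (hE _) hw' hes' hw hes hab.symm hx,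
        fun hx => closedWalk_subset_of_iterate_eq he (hE _) hw hes hw' hes' hab hx⟩
  · rintro _ ⟨j, rfl⟩ _ ⟨l, rfl⟩ hne
    rw [Set.disjoint_left]
    intro w hj hl
    refine hne ?_
    have hjl : SameComponent e (.state j) (.state l) :=
      SameComponent.trans hj (SameComponent.symm hl)
    have hiff : ∀ v, SameComponent e (.state j) v ↔ SameComponent e (.state l) v :=
      fun v => ⟨hjl.symm.trans, hjl.trans⟩
    simp only [component, hiff]
  · intro j _
    exact ⟨_, ⟨j, rfl⟩, SameComponent.refl _⟩

/-- Two states using the same column would have ingoing edges of equal tail and color.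
S-disjointness excludes this inside one subgraph, vertex-disjointness across two. -/
theorem exists_matching_of_isCoveredByGeneralizedCactus
    (h : P.IsCoveredByGeneralizedCactus univ) :
    ∃ g : Fin n → (Fin N × Fin n) ⊕ (Σ i : Fin N, Fin (m i)),
      Function.Injective g ∧ ∀ j, P.concat j (g j) := by
  obtain ⟨𝒞, hC, hdisj, hcov⟩ := h
  have hex : ∀ j : Fin n, ∃ G ∈ 𝒞, ∃ c, P.concat j c ∧ columnEdge j c ∈ G.edges := by
    intro j
    obtain ⟨G, hG, hj⟩ := hcov j (mem_univ j)
    obtain ⟨a, ⟨ha, haj⟩, -⟩ : ∃! a, a ∈ G.edges ∧ a.head = .state j :=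
      (hC G hG).elim (fun h => h.unique_ingoing j hj) fun h => h.unique_ingoing j hj
    obtain ⟨l, c, hlc, rfl⟩ := mem_edges_iff.1 (G.edges_subset ha)
    rw [columnEdge_head] at haj
    obtain rfl := Vertex.state.inj haj
    exact ⟨G, hG, c, hlc, ha⟩
  choose G hG g hg hgG using hex
  refine ⟨g, fun j l hjl => ?_, hg⟩
  by_contra hne
  have hedge : columnEdge (m := m) j (g j) ≠ columnEdge l (g l) := fun h => by
    have := congrArg ColoredEdge.head h
    rw [columnEdge_head, columnEdge_head] at this
    exact hne (Vertex.state.inj this)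
  have htail : (columnEdge (m := m) j (g j)).tail = (columnEdge l (g l)).tail := by
    rw [hjl]
    rcases g l with c | c <;> rfl
  have hcolor : (columnEdge (m := m) j (g j)).color = (columnEdge l (g l)).color := by
    rw [hjl]
    rcases g l with c | c <;> rfl
  by_cases hGG : G j = G l
  · have hS : SDisjoint (G j).edges :=
      (hC _ (hG j)).elim (fun h => h.sdisjoint) fun h => h.sdisjoint
    exact (hS _ (hgG j) _ (hGG ▸ hgG l) hedge).2 htail hcolor
  · exact Set.disjoint_left.1 (hdisj _ (hG j) _ (hG l) hGG) ((G j).tail_mem _ (hgG j))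
      (htail ▸ (G l).tail_mem _ (hgG l))

/-- The ingoing edge of an unreachable state starts at another unreachable state of the stem,
possibly itself; following these backwards would produce a cycle. -/
theorem Subgraph.IsGeneralizedStem.inputReachable {G : P.Subgraph} (h : G.IsGeneralizedStem)
    {j : Fin n} (hj : .state j ∈ G.verts) : P.InputReachable j := by
  classical
  by_contra hcon
  have hex : ∀ l : Fin n, ∃ a : ColoredEdge n N m, a.head = .state l ∧
      (.state l ∈ G.verts → a ∈ G.edges) := by
    intro l
    by_cases hl : .state l ∈ G.verts
    · obtain ⟨a, ⟨ha, hal⟩, -⟩ := h.unique_ingoing l hl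
      exact ⟨a, hal, fun _ => ha⟩
    · obtain ⟨i, k, -⟩ := h.unique_input.exists.choose_spec.2
      exact ⟨⟨.input i k, i, .state l⟩, rfl, fun h => absurd h hl⟩
  choose e he heG using hex
  obtain ⟨C, hC⟩ := exists_isCycle (E := G.edges) he
    (U := {l | .state l ∈ G.verts ∧ ¬ P.InputReachable l}) ⟨hj, hcon⟩ fun l hl => by
      refine ⟨heG l hl.1, ?_⟩
      have hmem := heG l hl.1
      have hmemP := G.edges_subset hmem
      have heq : e l = ⟨(e l).tail, (e l).color, .state l⟩ := by rw [← he l]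
      rcases htail : (e l).tail with k | ⟨i, k⟩
      · refine ⟨k, ⟨htail ▸ G.tail_mem _ hmem, fun hk => hl.2 ?_⟩, rfl⟩
        rw [heq, htail] at hmemP
        exact hk.step hmemP
      · rw [heq, htail] at hmemP
        exact absurd (InputReachable.of_input hmemP) hl.2
  exact h.no_cycle C hC

theorem inputReachable_of_isCoveredByGeneralizedCactus
    (h : P.IsCoveredByGeneralizedCactus univ) (j : Fin n) : P.InputReachable j := by
  obtain ⟨𝒞, hC, -, hcov⟩ := h
  obtain ⟨G, hG, hj⟩ := hcov j (mem_univ j)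
  exact (hC G hG).elim (fun h => h.inputReachable hj) fun h => h.input_reachable j hj

end StructuredSystem

/-! ### Functions that are differentiable off a finite set -/

theorem le_of_hasDerivAt_nonneg_off_finset {f : ℝ → ℝ} (S : Finset ℝ) {a b : ℝ} (hab : a ≤ b)
    (hf : ContinuousOn f (Icc a b))
    (hd : ∀ t ∈ Ioo a b, t ∉ S → ∃ d, 0 ≤ d ∧ HasDerivAt f d t) : f a ≤ f b := by
  induction S using Finset.induction_on generalizing a b with
  | empty =>
    refine monotoneOn_of_deriv_nonneg (convex_Icc a b) hf ?_ ?_ (left_mem_Icc.2 hab)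
      (right_mem_Icc.2 hab) hab
    · intro t ht
      rw [interior_Icc] at ht
      obtain ⟨d, -, h⟩ := hd t ht (Finset.notMem_empty t)
      exact h.differentiableAt.differentiableWithinAt
    · intro t ht
      rw [interior_Icc] at ht
      obtain ⟨d, h0, h⟩ := hd t ht (Finset.notMem_empty t)
      rwa [h.deriv]
  | insert c S _ ih =>
    by_cases hc : c ∈ Ioo a b
    · refine (ih hc.1.le (hf.mono (Icc_subset_Icc_right hc.2.le)) fun t ht hS => ?_).trans
        (ih hc.2.le (hf.mono (Icc_subset_Icc_left hc.1.le)) fun t ht hS => ?_)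
      · refine hd t ⟨ht.1, ht.2.trans hc.2⟩ ?_
        simp [hS, ht.2.ne]
      · refine hd t ⟨hc.1.trans ht.1, ht.2⟩ ?_
        simp [hS, ht.1.ne']
    · refine ih hab hf fun t ht hS => hd t ht ?_
      rw [Finset.mem_insert, not_or]
      exact ⟨fun h => hc (h ▸ ht), hS⟩

/-! ### The flow of a linear system with constant input -/

section Flow

open NormedSpace

variable {E : Type*} [NormedAddCommGroup E] [NormedSpace ℝ E]

/-- `∫₀ᵗ exp(rL) dr`. -/
noncomputable def expIntegral (L : E →L[ℝ] E) (t : ℝ) : E →L[ℝ] E :=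
  ∫ r in (0 : ℝ)..t, exp (r • L)

theorem exp_smul_zero_apply (L : E →L[ℝ] E) (x : E) : exp ((0 : ℝ) • L) x = x := by
  simp

theorem expIntegral_zero (L : E →L[ℝ] E) : expIntegral L 0 = 0 := by
  simp [expIntegral]

theorem mem_of_hasDerivAt_of_forall_pos [FiniteDimensional ℝ E] (W : Submodule ℝ E) {f : ℝ → E}
    {d : E} (hd : HasDerivAt f d 0) (h0 : f 0 ∈ W) (hf : ∀ t, 0 < t → f t ∈ W) : d ∈ W := by
  refine (Submodule.closed_of_finiteDimensional W).mem_of_tendsto hd.tendsto_slope_zero_right ?_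
  filter_upwards [self_mem_nhdsWithin] with t ht
  rw [zero_add]
  exact W.smul_mem _ (W.sub_mem (hf t ht) h0)

variable [CompleteSpace E]

theorem hasDerivAt_expIntegral (L : E →L[ℝ] E) (t : ℝ) :
    HasDerivAt (expIntegral L) (exp (t • L)) t := by
  have hc : Continuous fun r : ℝ => exp (r • L) :=
    continuous_iff_continuousAt.2 fun r => (hasDerivAt_exp_smul_const L r).continuousAt
  exact (hc.integral_hasStrictDerivAt 0 t).hasDerivAt

/-- Both sides have derivative `L * exp (t • L)` and agree at `0`. This identity shows that the
explicit flow solves the equation, without inverting `L`. -/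
theorem mul_expIntegral (L : E →L[ℝ] E) (t : ℝ) :
    L * expIntegral L t = exp (t • L) - 1 := by
  let G : ℝ → E →L[ℝ] E := fun s => exp (s • L) - L * expIntegral L s
  have hG : ∀ s, HasDerivAt G 0 s := by
    intro s
    have := (hasDerivAt_exp_smul_const' L s).sub ((hasDerivAt_expIntegral L s).const_mul L)
    rwa [sub_self] at this
  have h : G t = G 0 := is_const_of_deriv_eq_zero (fun s => (hG s).differentiableAt)
    (fun s => (hG s).deriv) t 0
  have h0 : G 0 = 1 := by simp [G, expIntegral]
  rw [h0] at h
  rw [← h]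
  simp [G]

theorem hasDerivAt_flow (L : E →L[ℝ] E) (x b : E) (t : ℝ) :
    HasDerivAt (fun s : ℝ => exp (s • L) x + expIntegral L s b)
      (L (exp (t • L) x + expIntegral L t b) + b) t := by
  have h1 := (hasDerivAt_exp_smul_const' L t).clm_apply (hasDerivAt_const t x)
  have h2 := (hasDerivAt_expIntegral L t).clm_apply (hasDerivAt_const t b)
  have h3 : L (expIntegral L t b) = exp (t • L) b - b :=
    congrArg (fun F : E →L[ℝ] E => F b) (mul_expIntegral L t)
  refine (h1.add h2).congr_deriv ?_
  rw [map_zero, map_zero, add_zero, add_zero, map_add, h3, add_assoc, sub_add_cancel]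
  rfl

theorem finrank_comap_exp [FiniteDimensional ℝ E] (L : E →L[ℝ] E) (V : Submodule ℝ E) :
    Module.finrank ℝ (V.comap (exp L : E →L[ℝ] E).toLinearMap) = Module.finrank ℝ V := by
  let : NormedAlgebra ℚ (E →L[ℝ] E) := NormedAlgebra.restrictScalars ℚ ℝ _
  have h : IsUnit (exp L) := isUnit_exp L
  obtain ⟨F, hF⟩ := h
  let e : E ≃L[ℝ] E := ContinuousLinearEquiv.unitsEquiv ℝ E F
  have he : V.comap (exp L : E →L[ℝ] E).toLinearMap = V.map e.symm.toLinearEquiv.toLinearMap := by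
    rw [← hF]
    exact Submodule.comap_equiv_eq_map_symm e.toLinearEquiv V
  rw [he]
  exact LinearEquiv.finrank_map_eq e.symm.toLinearEquiv V

end Flow

/-! ### Prefixing a phase with constant mode and input -/

section Prefix

variable {n N : ℕ} {m : Fin N → ℕ}

theorem tendsto_sub_nhdsGT (s t : ℝ) : Tendsto (fun r => r - t) (𝓝[>] s) (𝓝[>] (s - t)) := by
  refine tendsto_nhdsWithin_iff.2 ⟨?_, ?_⟩
  · exact ((continuous_id.sub continuous_const).tendsto s).mono_left nhdsWithin_le_nhds
  · filter_upwards [self_mem_nhdsWithin] with r hr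
    exact sub_lt_sub_right hr t

theorem tendsto_sub_nhdsLT (s t : ℝ) : Tendsto (fun r => r - t) (𝓝[<] s) (𝓝[<] (s - t)) := by
  refine tendsto_nhdsWithin_iff.2 ⟨?_, ?_⟩
  · exact ((continuous_id.sub continuous_const).tendsto s).mono_left nhdsWithin_le_nhds
  · filter_upwards [self_mem_nhdsWithin] with r hr
    exact sub_lt_sub_right hr t

/-- The function that equals `f` before time `t`, and `g`, restarted at time `t`, afterwards. -/
noncomputable def concatAt {X : Type*} (t : ℝ) (f g : ℝ → X) : ℝ → X :=
  fun s => if s < t then f s else g (s - t)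

section ConcatAt

variable {X : Type*} {t s : ℝ} (f g : ℝ → X)

theorem concatAt_of_lt (h : s < t) : concatAt t f g s = f s := if_pos h

theorem concatAt_of_le (h : t ≤ s) : concatAt t f g s = g (s - t) := if_neg h.not_gt

theorem concatAt_eventuallyEq_of_lt (h : s < t) : concatAt t f g =ᶠ[𝓝 s] f := by
  filter_upwards [Iio_mem_nhds h] with r hr
  exact concatAt_of_lt f g hr

theorem concatAt_eventuallyEq_of_gt (h : t < s) :
    concatAt t f g =ᶠ[𝓝 s] fun r => g (r - t) := by
  filter_upwards [Ioi_mem_nhds h] with r hr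
  exact concatAt_of_le f g (le_of_lt hr)

end ConcatAt

theorem IsSwitchingSignal.concatAt {tf t : ℝ} {σ : ℝ → Fin N} (h : IsSwitchingSignal tf σ)
    (i : Fin N) : IsSwitchingSignal (t + tf) (concatAt t (fun _ => i) σ) := by
  obtain ⟨S, hS⟩ := h
  refine ⟨insert t (S.image (· + t)), fun s s' h0 hss' hs' hr => ?_⟩
  rcases lt_or_ge s' t with h' | h'
  · rw [concatAt_of_lt _ _ h', concatAt_of_lt _ _ (hss'.trans_lt h')]
  · rcases lt_or_ge s t with h'' | h''
    · exact absurd ⟨h'', h'⟩ (hr t (Finset.mem_insert_self _ _))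
    · rw [concatAt_of_le _ _ h', concatAt_of_le _ _ h'']
      refine hS _ _ (sub_nonneg.2 h'') (sub_le_sub_right hss' t) (by linarith) fun r hrS hm => ?_
      refine hr (r + t) (Finset.mem_insert_of_mem (Finset.mem_image_of_mem _ hrS)) ?_
      exact ⟨by linarith [hm.1], by linarith [hm.2]⟩

theorem IsPiecewiseContinuous.concatAt {k : ℕ} {tf t : ℝ} {u : ℝ → Fin k → ℝ}
    (h : IsPiecewiseContinuous tf u) (c : Fin k → ℝ) :
    IsPiecewiseContinuous (t + tf) (concatAt t (fun _ => c) u) := by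
  obtain ⟨⟨S, hS⟩, hr, hl⟩ := h
  refine ⟨⟨insert t (S.image (· + t)), fun s hs hsS => ?_⟩, fun s hs => ?_, fun s hs => ?_⟩
  · rw [Finset.mem_insert, not_or] at hsS
    rcases lt_or_gt_of_ne hsS.1 with h' | h'
    · exact continuousAt_const.congr (concatAt_eventuallyEq_of_lt _ _ h').symm
    · refine ContinuousAt.congr ?_ (concatAt_eventuallyEq_of_gt _ _ h').symm
      refine ContinuousAt.comp (f := fun r : ℝ => r - t)
        (hS (s - t) ⟨by linarith, by linarith [hs.2]⟩ fun hm => ?_) (by fun_prop)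
      exact hsS.2 (Finset.mem_image.2 ⟨_, hm, sub_add_cancel s t⟩)
  · rcases lt_or_ge s t with h' | h'
    · exact ⟨c, tendsto_const_nhds.congr'
        ((concatAt_eventuallyEq_of_lt _ _ h').symm.filter_mono nhdsWithin_le_nhds)⟩
    · obtain ⟨l, hlim⟩ := hr (s - t) ⟨by linarith, by linarith [hs.2]⟩
      refine ⟨l, (hlim.comp (tendsto_sub_nhdsGT s t)).congr' ?_⟩
      filter_upwards [self_mem_nhdsWithin] with r hr
      exact (concatAt_of_le _ u (h'.trans (le_of_lt hr))).symm
  · rcases le_or_gt s t with h' | h'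
    · refine ⟨c, tendsto_const_nhds.congr' ?_⟩
      filter_upwards [self_mem_nhdsWithin] with r hr
      exact (concatAt_of_lt (fun _ => c) u (lt_of_lt_of_le hr h')).symm
    · obtain ⟨l, hlim⟩ := hl (s - t) ⟨by linarith, by linarith [hs.2]⟩
      exact ⟨l, (hlim.comp (tendsto_sub_nhdsLT s t)).congr'
        ((concatAt_eventuallyEq_of_gt _ _ h').symm.filter_mono nhdsWithin_le_nhds)⟩

namespace SwitchedSystem

/-- The drift of mode `i` as a continuous linear map. -/
noncomputable def drift (sys : SwitchedSystem n N m) (i : Fin N) :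
    (Fin n → ℝ) →L[ℝ] (Fin n → ℝ) :=
  (Matrix.mulVecLin (sys.A i)).toContinuousLinearMap

theorem drift_apply (sys : SwitchedSystem n N m) (i : Fin N) (x : Fin n → ℝ) :
    sys.drift i x = (sys.A i).mulVec x := rfl

variable {sys : SwitchedSystem n N m}

theorem IsTrajectory.concatAt {tf t : ℝ} (ht : 0 < t) (htf : 0 < tf) {σ : ℝ → Fin N}
    {u : ∀ i : Fin N, ℝ → Fin (m i) → ℝ} {x : ℝ → Fin n → ℝ} (h : sys.IsTrajectory tf σ u x)
    (i : Fin N) (c : ∀ i : Fin N, Fin (m i) → ℝ) {y : ℝ → Fin n → ℝ}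
    (hy : ∀ s, HasDerivAt y ((sys.A i).mulVec (y s) + (sys.B i).mulVec (c i)) s)
    (hyx : y t = x 0) :
    sys.IsTrajectory (t + tf) (concatAt t (fun _ => i) σ)
      (fun j => _root_.concatAt t (fun _ => c j) (u j)) (_root_.concatAt t y x) := by
  obtain ⟨hc, S, hS⟩ := h
  refine ⟨?_, insert t (S.image (· + t)), fun s hs hsS => ?_⟩
  · rw [← Icc_union_Icc_eq_Icc ht.le (by linarith : t ≤ t + tf)]
    refine ContinuousOn.union_of_isClosed ?_ ?_ isClosed_Icc isClosed_Icc
    · refine ContinuousOn.congr (f := y)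
        (fun s _ => (hy s).continuousAt.continuousWithinAt) fun s hs => ?_
      rcases hs.2.lt_or_eq with h' | h'
      · exact concatAt_of_lt _ _ h'
      · rw [h', concatAt_of_le _ _ le_rfl, sub_self, hyx]
    · refine ContinuousOn.congr (f := fun s => x (s - t)) ?_ fun s hs => concatAt_of_le _ _ hs.1
      refine hc.comp (by fun_prop) fun s hs => ⟨by linarith [hs.1], by linarith [hs.2]⟩
  · rw [Finset.mem_insert, not_or] at hsS
    rcases lt_or_gt_of_ne hsS.1 with h' | h'
    · beta_reduce
      rw [concatAt_of_lt (fun _ => i) σ h', concatAt_of_lt (fun _ => c i) (u i) h',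
        concatAt_of_lt y x h']
      exact (hy s).congr_of_eventuallyEq (concatAt_eventuallyEq_of_lt _ _ h')
    · beta_reduce
      rw [concatAt_of_le (fun _ => i) σ h'.le, concatAt_of_le _ (u (σ (s - t))) h'.le,
        concatAt_of_le y x h'.le]
      refine HasDerivAt.congr_of_eventuallyEq ?_ (concatAt_eventuallyEq_of_gt _ _ h')
      refine HasDerivAt.comp_sub_const s t
        (hS (s - t) ⟨by linarith, by linarith [hs.2]⟩ fun hm => ?_)
      exact hsS.2 (Finset.mem_image.2 ⟨_, hm, sub_add_cancel s t⟩)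

theorem isControllableState_of_flow {i : Fin N} {t : ℝ} (ht : 0 < t) (v : Fin (m i) → ℝ)
    {x₀ : Fin n → ℝ}
    (h : sys.IsControllableState (NormedSpace.exp (t • sys.drift i) x₀ +
      expIntegral (sys.drift i) t ((sys.B i).mulVec v))) :
    sys.IsControllableState x₀ := by
  obtain ⟨tf, htf, σ, hσ, u, hu, x, hx, hx0, hxf⟩ := h
  -- During the prefixed phase only mode `i` is active; the inputs of the other modes are set to
  -- zero.
  have hc : (Pi.single i v : ∀ j, Fin (m j) → ℝ) i = v :=
    Pi.single_eq_same (M := fun j => Fin (m j) → ℝ) i v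
  refine ⟨t + tf, by linarith, _, hσ.concatAt i, _,
    fun j => (hu j).concatAt ((Pi.single i v : ∀ j, Fin (m j) → ℝ) j), _,
    hx.concatAt ht htf i _ (y := fun s => NormedSpace.exp (s • sys.drift i) x₀ +
      expIntegral (sys.drift i) s ((sys.B i).mulVec v)) (fun s => ?_) hx0.symm, ?_, ?_⟩
  · rw [hc]
    exact hasDerivAt_flow (sys.drift i) x₀ ((sys.B i).mulVec v) s
  · rw [concatAt_of_lt _ _ ht, exp_smul_zero_apply, expIntegral_zero]
    simp
  · rw [concatAt_of_le _ _ (by linarith), add_sub_cancel_left, hxf]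

/-- The zero trajectory works, but a switching signal exists only if there is a mode. -/
theorem isControllableState_zero (hN : 1 ≤ N) : sys.IsControllableState 0 := by
  refine ⟨1, one_pos, fun _ => ⟨0, hN⟩, ⟨∅, fun _ _ _ _ _ _ => rfl⟩, fun _ _ => 0, fun i => ?_,
    fun _ => 0, ⟨continuousOn_const, ∅, fun t _ _ => ?_⟩, rfl, rfl⟩
  · exact ⟨⟨∅, fun _ _ _ => continuousAt_const⟩, fun _ _ => ⟨0, tendsto_const_nhds⟩,
      fun _ _ => ⟨0, tendsto_const_nhds⟩⟩
  · simpa using hasDerivAt_const t (0 : Fin n → ℝ)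

/-- The flow moves `x` to a vector of `V` plus a response to some constant input; applying the
opposite input cancels the response and leaves a state of `V`. -/
theorem isControllableState_of_mem_comap {V : Submodule ℝ (Fin n → ℝ)}
    (hV : ∀ x ∈ V, sys.IsControllableState x) (i : Fin N) {t : ℝ} (ht : 0 < t) :
    ∀ x ∈ (V ⊔ (Matrix.mulVecLin (sys.B i)).range.map
        (expIntegral (sys.drift i) t).toLinearMap).comap
        (NormedSpace.exp (t • sys.drift i)).toLinearMap, sys.IsControllableState x := by
  intro x hx
  obtain ⟨y, hy, z, hz, hyz⟩ := Submodule.mem_sup.1 (Submodule.mem_comap.1 hx)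
  obtain ⟨_, ⟨v, rfl⟩, rfl⟩ := hz
  refine isControllableState_of_flow ht (-v) ?_
  convert hV y hy using 1
  have hyz' : y + expIntegral (sys.drift i) t ((sys.B i).mulVec v) =
    NormedSpace.exp (t • sys.drift i) x := hyz
  rw [← hyz', Matrix.mulVec_neg, map_neg, add_neg_cancel_right]

/-- If no proper subspace is invariant under all drifts and contains the images of all input
matrices, then the system is controllable. -/
theorem isControllable_of_invariant (hN : 1 ≤ N)
    (h : ∀ W : Submodule ℝ (Fin n → ℝ), (∀ i v, (sys.B i).mulVec v ∈ W) →
      (∀ i, ∀ x ∈ W, (sys.A i).mulVec x ∈ W) → W = ⊤) : sys.IsControllable := by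
  let C : Set (Submodule ℝ (Fin n → ℝ)) := {V | ∀ x ∈ V, sys.IsControllableState x}
  let D : Set ℕ := (fun V : Submodule ℝ (Fin n → ℝ) => Module.finrank ℝ V) '' C
  have hbot : ⊥ ∈ C := fun x hx => by
    rw [(Submodule.mem_bot ℝ).1 hx]
    exact isControllableState_zero hN
  have hbdd : BddAbove D := by
    refine ⟨Module.finrank ℝ (Fin n → ℝ), ?_⟩
    rintro _ ⟨V, -, rfl⟩
    exact V.finrank_le
  obtain ⟨V₀, hV₀, hd⟩ : sSup D ∈ D := Nat.sSup_mem ⟨_, ⊥, hbot, rfl⟩ hbdd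
  -- The controllable set is not known to be a subspace, hence the detour through all subspaces of
  -- maximal dimension inside it.
  let M : Set (Submodule ℝ (Fin n → ℝ)) := {V | V ∈ C ∧ Module.finrank ℝ V = sSup D}
  have hresp : ∀ V ∈ M, ∀ i (t : ℝ), 0 < t → ∀ v,
      expIntegral (sys.drift i) t ((sys.B i).mulVec v) ∈ V := by
    intro V hV i t ht v
    have hmem := isControllableState_of_mem_comap hV.1 i ht
    -- Pulling back along the invertible flow keeps dimensions, so enlarging `V` by the responses
    -- must not increase its dimension.
    have hle := le_csSup hbdd ⟨_, hmem, rfl⟩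
    dsimp only at hle
    rw [finrank_comap_exp, ← hV.2] at hle
    rw [Submodule.eq_of_le_of_finrank_le le_sup_left hle]
    exact Submodule.mem_sup_right ⟨_, ⟨v, rfl⟩, rfl⟩
  have hflow : ∀ V ∈ M, ∀ i (t : ℝ), 0 < t →
      V.comap (NormedSpace.exp (t • sys.drift i)).toLinearMap ∈ M := by
    intro V hV i t ht
    refine ⟨fun x hx => isControllableState_of_mem_comap hV.1 i ht x ?_, ?_⟩
    · exact Submodule.comap_mono le_sup_left hx
    · rw [finrank_comap_exp, hV.2]
  have htop : sInf M = ⊤ := by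
    -- Right derivatives at time `0` of the responses and of the flow yield `B_i v` and `A_i x`;
    -- subspaces are closed, so they stay inside.
    refine h _ (fun i v => ?_) fun i x hx => ?_
    · refine Submodule.mem_sInf.2 fun V hV => ?_
      have hder := (hasDerivAt_expIntegral (sys.drift i) 0).clm_apply
        (hasDerivAt_const 0 ((sys.B i).mulVec v))
      have := mem_of_hasDerivAt_of_forall_pos V hder (by simp [expIntegral_zero])
        fun t ht => hresp V hV i t ht v
      simpa using this
    · have hder := hasDerivAt_flow (sys.drift i) x 0 0
      have := mem_of_hasDerivAt_of_forall_pos (sInf M) hder (by simpa using hx) fun t ht => ?_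
      · simpa [drift_apply] using this
      · rw [map_zero, add_zero]
        refine Submodule.mem_sInf.2 fun V hV => ?_
        exact Submodule.mem_sInf.1 hx _ (hflow V hV i t ht)
  refine eq_univ_of_forall fun x => hV₀ x ?_
  have : sInf M ≤ V₀ := sInf_le ⟨hV₀, hd⟩
  rw [htop] at this
  exact this trivial

/-! ### Obstructions to controllability -/

/-- A row vector that annihilates all matrices of a controllable system is zero. -/
theorem IsControllable.eq_zero_of_annihilates (h : sys.IsControllable) {q : Fin n → ℝ}
    (hA : ∀ i, Matrix.vecMul q (sys.A i) = 0) (hB : ∀ i, Matrix.vecMul q (sys.B i) = 0) :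
    q = 0 := by
  -- Starting at `-q`, the constant quantity `-(q ⬝ᵥ x t)` begins at `q ⬝ᵥ q` and ends at `0`.
  obtain ⟨tf, htf, σ, -, u, -, x, ⟨hc, S, hS⟩, hx0, hxf⟩ :=
    (Set.eq_univ_iff_forall.1 h (-q) : sys.IsControllableState (-q))
  have hd : ∀ t ∈ Ioo 0 tf, t ∉ S → ∃ d, 0 ≤ d ∧ HasDerivAt (fun t => - (q ⬝ᵥ x t)) d t := by
    intro t ht htS
    refine ⟨0, le_rfl, ?_⟩
    have h1 := hasDerivAt_pi.1 (hS t ht htS)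
    have h2 : HasDerivAt (fun t => ∑ j, q j * x t j) _ t :=
      HasDerivAt.fun_sum fun j _ => (h1 j).const_mul (q j)
    refine h2.neg.congr_deriv ?_
    have h3 : q ⬝ᵥ ((sys.A (σ t)).mulVec (x t) + (sys.B (σ t)).mulVec (u (σ t) t)) = 0 := by
      rw [dotProduct_add, Matrix.dotProduct_mulVec, Matrix.dotProduct_mulVec, hA, hB]
      simp
    rw [neg_eq_zero]
    exact h3
  have hcont : ContinuousOn (fun t => - (q ⬝ᵥ x t)) (Icc 0 tf) := by
    refine (continuousOn_finsetSum _ fun j _ => ?_).neg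
    exact continuousOn_const.mul (continuousOn_pi.1 hc j)
  have := le_of_hasDerivAt_nonneg_off_finset S htf.le hcont hd
  simp only [hx0, hxf, dotProduct_neg, neg_neg, dotProduct_zero, neg_zero] at this
  have h0 : q ⬝ᵥ q = 0 := le_antisymm this (Finset.sum_nonneg fun j _ => mul_self_nonneg _)
  exact dotProduct_self_eq_zero.1 h0

/-- In a controllable system, a set of states that is influenced neither by the inputs nor by the
other states is empty. -/
theorem IsControllable.notMem_of_autonomous (h : sys.IsControllable) (U : Finset (Fin n))
    (hA : ∀ i, ∀ j ∈ U, ∀ k ∉ U, sys.A i j k = 0) (hB : ∀ i, ∀ j ∈ U, ∀ k, sys.B i j k = 0)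
    (j₀ : Fin n) : j₀ ∉ U := by
  intro hj₀
  obtain ⟨tf, htf, σ, -, u, -, x, ⟨hc, S, hS⟩, hx0, hxf⟩ :=
    (Set.eq_univ_iff_forall.1 h (Pi.single j₀ 1) : sys.IsControllableState (Pi.single j₀ 1))
  -- With this `K`, valid for all modes at once, `|z'| ≤ K z`; so `exp (K t) z` is nondecreasing,
  -- and `z`, at least `1` initially, cannot vanish.
  let K : ℝ := 2 * ∑ i, ∑ j, ∑ k, |sys.A i j k|
  let z : ℝ → ℝ := fun t => ∑ j ∈ U, x t j ^ 2
  have hz : ∀ t, ∀ j ∈ U, x t j ^ 2 ≤ z t := fun t j hj =>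
    Finset.single_le_sum (f := fun j => x t j ^ 2) (fun _ _ => sq_nonneg _) hj
  have hcont : ContinuousOn (fun t => Real.exp (K * t) * z t) (Icc 0 tf) := by
    refine ContinuousOn.mul (by fun_prop) (continuousOn_finsetSum _ fun j _ => ?_)
    exact (continuousOn_pi.1 hc j).pow 2
  have hd : ∀ t ∈ Ioo 0 tf, t ∉ S →
      ∃ d, 0 ≤ d ∧ HasDerivAt (fun t => Real.exp (K * t) * z t) d t := by
    intro t ht htS
    have h1 := hasDerivAt_pi.1 (hS t ht htS)
    have h2 : HasDerivAt z (∑ j ∈ U, 2 * x t j * ∑ k ∈ U, sys.A (σ t) j k * x t k) t := by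
      refine HasDerivAt.fun_sum fun j hj => ((h1 j).pow 2).congr_deriv ?_
      have h3 : ((sys.B (σ t)).mulVec (u (σ t) t)) j = 0 := by
        simp [Matrix.mulVec, dotProduct, hB _ j hj]
      have h4 : ((sys.A (σ t)).mulVec (x t)) j = ∑ k ∈ U, sys.A (σ t) j k * x t k := by
        refine (Finset.sum_subset (Finset.subset_univ U) fun k _ hk => ?_).symm
        exact mul_eq_zero_of_left (hA _ j hj k hk) _
      rw [Pi.add_apply, h3, h4]
      norm_num
    have h5 : HasDerivAt (fun t => Real.exp (K * t)) (Real.exp (K * t) * K) t := by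
      simpa using ((hasDerivAt_id t).const_mul K).exp
    refine ⟨_, ?_, h5.mul h2⟩
    have hz0 : 0 ≤ z t := Finset.sum_nonneg fun _ _ => sq_nonneg _
    have h6 : |∑ j ∈ U, 2 * x t j * ∑ k ∈ U, sys.A (σ t) j k * x t k| ≤ K * z t := by
      have h7 : |∑ j ∈ U, 2 * x t j * ∑ k ∈ U, sys.A (σ t) j k * x t k| ≤
          2 * ∑ j ∈ U, ∑ k ∈ U, |sys.A (σ t) j k| * z t := by
        rw [Finset.mul_sum]
        refine (Finset.abs_sum_le_sum_abs _ _).trans (Finset.sum_le_sum fun j hj => ?_)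
        rw [mul_assoc, abs_mul, abs_two, Finset.mul_sum]
        refine mul_le_mul_of_nonneg_left ?_ zero_le_two
        refine (Finset.abs_sum_le_sum_abs _ _).trans (Finset.sum_le_sum fun k hk => ?_)
        rw [mul_left_comm, abs_mul]
        refine mul_le_mul_of_nonneg_left (abs_le.2 ?_) (abs_nonneg _)
        have hj' := hz t j hj
        have hk' := hz t k hk
        -- `2 |x_j x_k| ≤ x_j² + x_k² ≤ 2 z`.
        constructor <;> nlinarith [sq_nonneg (x t j + x t k), sq_nonneg (x t j - x t k)]
      refine h7.trans ?_
      simp only [K, ← Finset.sum_mul, ← mul_assoc]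
      refine mul_le_mul_of_nonneg_right (mul_le_mul_of_nonneg_left ?_ zero_le_two) hz0
      calc ∑ j ∈ U, ∑ k ∈ U, |sys.A (σ t) j k|
          ≤ ∑ j ∈ U, ∑ k, |sys.A (σ t) j k| := Finset.sum_le_sum fun j _ =>
            Finset.sum_le_univ_sum_of_nonneg fun _ => abs_nonneg _
        _ ≤ ∑ j, ∑ k, |sys.A (σ t) j k| :=
            Finset.sum_le_univ_sum_of_nonneg fun _ => Finset.sum_nonneg fun _ _ => abs_nonneg _
        _ ≤ ∑ i, ∑ j, ∑ k, |sys.A i j k| :=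
            Finset.single_le_sum (f := fun i => ∑ j, ∑ k, |sys.A i j k|)
              (fun _ _ => Finset.sum_nonneg fun _ _ => Finset.sum_nonneg fun _ _ => abs_nonneg _)
              (Finset.mem_univ _)
    have h8 := (abs_le.1 h6).1
    rw [mul_assoc, ← mul_add]
    exact mul_nonneg (Real.exp_pos _).le (by linarith)
  have h9 := le_of_hasDerivAt_nonneg_off_finset S htf.le hcont hd
  have h10 : z tf = 0 := Finset.sum_eq_zero fun j _ => by simp [hxf]
  have h11 := hz 0 j₀ hj₀
  rw [hx0, Pi.single_eq_same] at h11
  rw [h10, mul_zero, mul_zero, Real.exp_zero, one_mul] at h9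
  linarith

end SwitchedSystem

end Prefix

/-! ### Structural controllability -/

namespace StructuredSystem

variable {n N : ℕ} {m : Fin N → ℕ} {P : StructuredSystem n N m}

theorem isStructurallyControllable_of_inputReachable_of_grank (hN : 1 ≤ N)
    (hreach : ∀ j, P.InputReachable j) (hrank : P.concat.grank = n) :
    P.IsStructurallyControllable := by
  obtain ⟨M₀, hM₀, g, hg⟩ := exists_det_ne_zero_of_grank_eq hrank
  obtain ⟨M, hM, htop⟩ := exists_realization_span_wordVec_eq_top
    (fun k => (hreach k).patternReachable) hM₀ hg
  refine ⟨⟨fun i j k => M j (.inl (i, k)), fun i j k => M j (.inr ⟨i, k⟩)⟩,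
    fun i => ⟨fun j k h => hM j (.inl (i, k)) h, fun j k h => hM j (.inr ⟨i, k⟩) h⟩,
    SwitchedSystem.isControllable_of_invariant hN fun W hB hA => htop W fun u w => ?_⟩
  induction w with
  | nil =>
    convert hB u.1 (Pi.single u.2 1) using 1
    rw [Matrix.mulVec_single_one]
    rfl
  | cons i w ih => exact hA i _ ih

theorem grank_eq_of_isControllable {sys : SwitchedSystem n N m} (hP : P.IsRealization sys)
    (h : sys.IsControllable) : P.concat.grank = n := by
  let M : Matrix (Fin n) ((Fin N × Fin n) ⊕ (Σ i : Fin N, Fin (m i))) ℝ :=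
    fun j c => Sum.elim (fun p => sys.A p.1 j p.2) (fun q => sys.B q.1 j q.2) c
  refine grank_eq_of_span (M := M) ?_ ?_
  · rintro j (⟨i, k⟩ | ⟨i, k⟩) hjc
    · exact (hP i).1 j k hjc
    · exact (hP i).2 j k hjc
  · by_contra hne
    obtain ⟨q, hq0, hq⟩ := exists_annihilator_of_ne_top _ hne
    refine hq0 (h.eq_zero_of_annihilates (fun i => funext fun k => ?_) fun i => funext fun k => ?_)
    · exact hq _ (Submodule.subset_span ⟨.inl (i, k), rfl⟩)
    · exact hq _ (Submodule.subset_span ⟨.inr ⟨i, k⟩, rfl⟩)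

theorem inputReachable_of_isControllable {sys : SwitchedSystem n N m} (hP : P.IsRealization sys)
    (h : sys.IsControllable) (j : Fin n) : P.InputReachable j := by
  classical
  have hmem : ∀ l, l ∈ Finset.univ.filter (fun l => ¬ P.InputReachable l) ↔
      ¬ P.InputReachable l := fun l => by simp
  -- No edge enters the set of unreachable states from an input or from a reachable state, so the
  -- corresponding entries are fixed zeros.
  refine not_not.1 fun hj => h.notMem_of_autonomous
    (Finset.univ.filter fun l => ¬ P.InputReachable l) (fun i l hl k hk => ?_)
    (fun i l hl k => ?_) j ((hmem j).2 hj)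
  · rw [hmem] at hl hk
    refine (hP i).1 l k fun hlk => hl ((not_not.1 hk).step (c := i) ?_)
    exact .inl ⟨i, l, k, hlk, rfl⟩
  · rw [hmem] at hl
    refine (hP i).2 l k fun hlk => hl (.of_input (i := i) (k := k) (c := i) ?_)
    exact .inr ⟨i, l, k, hlk, rfl⟩

end StructuredSystem

theorem theorem2 (n N : ℕ) (hN : 1 ≤ N) (m : Fin N → ℕ) (P : StructuredSystem n N m) :
    List.TFAE [
      (∀ j : Fin n, P.InputReachable j) ∧ P.concat.grank = n,
      P.IsCoveredByGeneralizedCactus Set.univ,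
      P.IsStructurallyControllable] := by
  tfae_have 1 → 2 := fun h =>
    let ⟨_, hinj, hg⟩ := StructuredSystem.grank_eq_iff_exists_matching.1 h.2
    StructuredSystem.isCoveredByGeneralizedCactus_of_matching hinj hg h.1
  tfae_have 2 → 1 := fun h => ⟨StructuredSystem.inputReachable_of_isCoveredByGeneralizedCactus h,
    StructuredSystem.grank_eq_iff_exists_matching.2
      (StructuredSystem.exists_matching_of_isCoveredByGeneralizedCactus h)⟩
  tfae_have 1 → 3 := fun h =>
    StructuredSystem.isStructurallyControllable_of_inputReachable_of_grank hN h.1 h.2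
  tfae_have 3 → 1 := fun ⟨_, hP, h⟩ =>
    ⟨StructuredSystem.inputReachable_of_isControllable hP h,
      StructuredSystem.grank_eq_of_isControllable hP h⟩
  tfae_finish
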